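/- Let $T^N=\{\zeta\in\mathbb C^N : |\zeta_i|=1\}$ act on $\mathbb H^N\cong\mathbb C^N\times\mathbb C^N$ by $(z,w)\zeta=(z\zeta,w\zeta^{-1})$. Let $K\subset T^N$ be a connected (closed) subtorus with Lie algebra $k\subset t^N=\mathbb R^N$ and inclusion $\iota\colon k\to t^N$, let $K_{\mathbb C}$ be its complexification, let $T^n=T^N/K$, and let $u_1,\dots,u_N\in(t^N)^*$ be the standard dual basis. The hyperkähler moment map for $K$ is $$\mu_1(z,w)=\pi\sum_{i=1}^N(|z_i|^2-|w_i|^2)\,\iota^*u_i\in k^*,\qquad \mu_{\mathbb C}(z,w)=-2\pi\sqrt{-1}\sum_{i=1}^N z_iw_i\,\iota^*u_i\in k_{\mathbb C}^*,$$ and $X(\alpha,\beta)=(\mu_1^{-1}(\alpha)\cap\mu_{\mathbb C}^{-1}(\beta))/K$ for $(\alpha,\beta)\in k^*\times k_{\mathbb C}^*$, with its induced $T^n$-action. A point $(z,w)\in\mu_{\mathbb C}^{-1}(\beta)$ is called $\alpha$-semi-stable if $\alpha\in\sum_i\mathbb R_{\ge0}|z_i|^2\iota^*u_i+\sum_i\mathbb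 R_{\ge0}|w_i|^2(-\iota^*u_i)$. Write $\mu_{\mathbb C}^{-1}(\beta)^{\alpha\text{-}ss}/\!/K_{\mathbb C}$ for the quotient of the set of $\alpha$-semi-stable points that identifies points whose $K_{\mathbb C}$-orbits have intersecting closures in it. All points of $\mu_{\mathbb C}^{-1}(\beta)$ are $0$-semi-stable, and the natural map $X(0,\beta)\to\mu_{\mathbb C}^{-1}(\beta)/\!/K_{\mathbb C}$ is a bijection. The natural morphism $\pi_1\colon X(\alpha,\beta)\to X(0,\beta)$ is the composition of the natural map $X(\alpha,\beta)\to\mu_{\mathbb C}^{-1}(\beta)^{\alpha\text{-}ss}/\!/K_{\mathbb C}$, the map $\mu_{\mathbb C}^{-1}(\beta)^{\alpha\text{-}ss}/\!/K_{\mathbb C}\to\mu_{\mathbb C}^{-1}(\beta)/\!/K_{\mathbb C}$ induced by the inclusion, and the inverse of this bijection. For $\epsilon\colon\{1,\dots,N\}\to\{1,-1\}$ let $V_\epsilon$ be the set of $(z,w)$ with $w_i=0$ whenever $\epsilon(i)=1$ and $z_i=0$ whenever $\epsilon(i)=-1$. Set $M_\epsilon(\alpha)=(V_\epsilon\cap\mu_1^{-1}(\alpha))/K\subset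 X(\alpha,0)$ and $\Theta_{cpt}(\alpha)=\{\epsilon : M_\epsilon(\alpha)\text{ is compact}\}$. **Proposition.** Fix any $\alpha\in k^*$, and let $\pi_1\colon X(\alpha,0)\to X(0,0)$ be the natural morphism. Then: (1) $\pi_1^{-1}([0,0])$ is a $T^n$-equivariant deformation retract of $X(\alpha,0)$: there is a continuous $H\colon[0,1]\times X(\alpha,0)\to X(\alpha,0)$ such that each $H_t$ is $T^n$-equivariant, $H_0=\mathrm{id}$, $H_1$ has image in $\pi_1^{-1}([0,0])$, and every $H_t$ fixes $\pi_1^{-1}([0,0])$ pointwise. (2) If moreover $\iota^*u_i\neq0$ for all $i=1,\dots,N$, then $$\pi_1^{-1}([0,0])=\bigcup_{\epsilon\in\Theta_{cpt}(\alpha)}M_\epsilon(\alpha).$$ -/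

import Mathlib

open Topology Filter

namespace ToricHK

noncomputable section

/-! ### Tori -/

/-- A connected subtorus of `T^N`: a closed connected subgroup. -/
structure Subtorus (N : ℕ) extends Subgroup (Fin N → Circle) where
  isClosed' : IsClosed carrier
  isConnected' : IsConnected carrier

/-- The exponential map `t^N = ℝ^N → T^N`, whose kernel is the lattice `ℤ^N`. -/
def expT {N : ℕ} (X : Fin N → ℝ) : Fin N → Circle := fun i => Circle.exp (2 * Real.pi * X i)

/-- The map `X ↦ Exp (√-1 X)` from `t^N` to the complex torus. -/
def expI {N : ℕ} (X : Fin N → ℝ) : Fin N → ℂˣ := fun i =>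
  Units.mk0 (Complex.exp (2 * Real.pi * Complex.I * (Complex.I * X i))) (Complex.exp_ne_zero _)

/-- The inclusion of the real torus into the complex torus. -/
def toComplexTorus {N : ℕ} : (Fin N → Circle) →* (Fin N → ℂˣ) where
  toFun ζ := fun i => Circle.toUnits (ζ i)
  map_one' := by ext i; simp
  map_mul' a b := by ext i; simp

lemma norm_toComplexTorus {N : ℕ} (ζ : Fin N → Circle) (i : Fin N) :
    ‖(toComplexTorus ζ i : ℂ)‖ = 1 := Circle.norm_coe (ζ i)

lemma expT_zero {N : ℕ} : expT (0 : Fin N → ℝ) = 1 := by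
  funext i; simp [expT]

lemma expT_add {N : ℕ} (X Y : Fin N → ℝ) : expT (X + Y) = expT X * expT Y := by
  funext i; simp [expT, mul_add, Circle.exp_add]

lemma expI_zero {N : ℕ} : expI (0 : Fin N → ℝ) = 1 := by
  funext i; ext; simp [expI]

lemma expI_add {N : ℕ} (X Y : Fin N → ℝ) : expI (X + Y) = expI X * expI Y := by
  funext i; ext; simp [expI, mul_add, Complex.exp_add]

lemma expI_neg {N : ℕ} (X : Fin N → ℝ) : expI (-X) = (expI X)⁻¹ := by
  rw [eq_inv_iff_mul_eq_one, ← expI_add, neg_add_cancel, expI_zero]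

variable {N : ℕ} (K : Subtorus N)

/-- The Lie algebra `k ⊂ t^N` of `K`. -/
def Subtorus.lie : Submodule ℝ (Fin N → ℝ) where
  carrier := {X | ∀ t : ℝ, expT (t • X) ∈ K.toSubgroup}
  zero_mem' t := by rw [smul_zero, expT_zero]; exact one_mem _
  add_mem' {X Y} hX hY t := by rw [smul_add, expT_add]; exact mul_mem (hX t) (hY t)
  smul_mem' c X hX t := by rw [smul_smul]; exact hX _

/-- The complexification `K_ℂ = K · Exp (√-1 k)` of `K`. -/
def Subtorus.complexification : Subgroup (Fin N → ℂˣ) where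
  carrier := {ζ | ∃ κ ∈ K.toSubgroup, ∃ Y ∈ K.lie, ζ = toComplexTorus κ * expI Y}
  one_mem' := ⟨1, one_mem _, 0, zero_mem _, by rw [map_one, expI_zero, mul_one]⟩
  mul_mem' := by
    rintro _ _ ⟨κ, hκ, Y, hY, rfl⟩ ⟨κ', hκ', Y', hY', rfl⟩
    exact ⟨κ * κ', mul_mem hκ hκ', Y + Y', add_mem hY hY', by
      rw [map_mul, expI_add, mul_mul_mul_comm]⟩
  inv_mem' := by
    rintro _ ⟨κ, hκ, Y, hY, rfl⟩
    exact ⟨κ⁻¹, inv_mem hκ, -Y, neg_mem hY, by rw [map_inv, expI_neg, mul_inv]⟩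

/-- The quotient torus `T^n = T^N / K`. -/
abbrev Subtorus.quotientTorus : Type := (Fin N → Circle) ⧸ K.toSubgroup

/-! ### The quaternionic vector space and the moment maps -/

/-- `ℍ^N`, identified with `ℂ^N × ℂ^N` by `ξ = z + w I₂`. -/
abbrev HSpace (N : ℕ) : Type := (Fin N → ℂ) × (Fin N → ℂ)

/-- The action `(z, w) ζ = (z ζ, w ζ⁻¹)` of the complex torus on `ℍ^N`. -/
def actC (ζ : Fin N → ℂˣ) (p : HSpace N) : HSpace N :=
  (fun i => p.1 i * (ζ i : ℂ), fun i => p.2 i * (((ζ i)⁻¹ : ℂˣ) : ℂ))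

/-- The action of the real torus on `ℍ^N`. -/
def act (ζ : Fin N → Circle) (p : HSpace N) : HSpace N := actC (toComplexTorus ζ) p

/-- The element `ι^* u_i ∈ k^*`. -/
def Subtorus.u (i : Fin N) : Module.Dual ℝ K.lie :=
  K.lie.subtype.dualMap (LinearMap.proj i)

/-- The real moment map `μ₁ : ℍ^N → k^*`. -/
def mu1 (p : HSpace N) : Module.Dual ℝ K.lie :=
  Real.pi • ∑ i, (‖p.1 i‖ ^ 2 - ‖p.2 i‖ ^ 2) • K.u i

/-- The complex moment map `μ_ℂ : ℍ^N → k_ℂ^*`, where `k_ℂ^* = Hom_ℝ(k, ℂ)`. -/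
def muC (p : HSpace N) : K.lie →ₗ[ℝ] ℂ :=
  (-2 * Real.pi * Complex.I : ℂ) • ∑ i, (K.u i).smulRight (p.1 i * p.2 i)

/-! ### Toric hyperkähler varieties -/

lemma actC_one (p : HSpace N) : actC 1 p = p := by
  simp [actC]

lemma actC_mul (ζ η : Fin N → ℂˣ) (p : HSpace N) : actC (ζ * η) p = actC ζ (actC η p) := by
  refine Prod.ext ?_ ?_ <;> funext i <;> simp [actC] <;> ring

lemma act_one (p : HSpace N) : act 1 p = p := by rw [act, map_one, actC_one]

lemma act_mul (ζ η : Fin N → Circle) (p : HSpace N) : act (ζ * η) p = act ζ (act η p) := by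
  rw [act, map_mul, actC_mul]; rfl

lemma mu1_act (ζ : Fin N → Circle) (p : HSpace N) : mu1 K (act ζ p) = mu1 K p := by
  simp [mu1, act, actC, norm_toComplexTorus]

lemma muC_actC (ζ : Fin N → ℂˣ) (p : HSpace N) : muC K (actC ζ p) = muC K p := by
  have h : ∀ i, (actC ζ p).1 i * (actC ζ p).2 i = p.1 i * p.2 i := fun i => by
    simp only [actC]
    rw [mul_mul_mul_comm, Units.mul_inv, mul_one]
  simp only [muC, h]

/-- The level set `μ⁻¹(α, β)`. -/
def levelSet (α : Module.Dual ℝ K.lie) (β : K.lie →ₗ[ℝ] ℂ) : Set (HSpace N) :=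
  {p | mu1 K p = α ∧ muC K p = β}

/-- The orbit relation of `K` on `μ⁻¹(α, β)`. -/
def orbitSetoid (α : Module.Dual ℝ K.lie) (β : K.lie →ₗ[ℝ] ℂ) : Setoid (levelSet K α β) where
  r p q := ∃ κ ∈ K.toSubgroup, act κ p.1 = q.1
  iseqv :=
    { refl := fun p => ⟨1, one_mem _, act_one _⟩
      symm := by
        rintro p q ⟨κ, hκ, h⟩
        exact ⟨κ⁻¹, inv_mem hκ, by rw [← h, ← act_mul, inv_mul_cancel, act_one]⟩
      trans := by
        rintro p q r ⟨κ, hκ, h⟩ ⟨κ', hκ', h'⟩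
        exact ⟨κ' * κ, mul_mem hκ' hκ, by rw [act_mul, h, h']⟩ }

/-- The toric hyperkähler variety `X(α, β) = μ⁻¹(α, β) / K`. -/
def X (α : Module.Dual ℝ K.lie) (β : K.lie →ₗ[ℝ] ℂ) : Type := Quotient (orbitSetoid K α β)

/-- The quotient topology of the subspace topology on `μ⁻¹(α, β)`. -/
instance (α : Module.Dual ℝ K.lie) (β : K.lie →ₗ[ℝ] ℂ) : TopologicalSpace (X K α β) :=
  inferInstanceAs (TopologicalSpace (Quotient (orbitSetoid K α β)))

/-- The projection `(z, w) ↦ [z, w]`. -/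
def X.mk {α : Module.Dual ℝ K.lie} {β : K.lie →ₗ[ℝ] ℂ} (p : levelSet K α β) : X K α β :=
  Quotient.mk (orbitSetoid K α β) p

/-- The action of `T^N` on the level set `μ⁻¹(α, β)`. -/
def actLevel {α : Module.Dual ℝ K.lie} {β : K.lie →ₗ[ℝ] ℂ} (ζ : Fin N → Circle)
    (p : levelSet K α β) : levelSet K α β :=
  ⟨act ζ p.1, (mu1_act K ζ p.1).trans p.2.1, (muC_actC K _ p.1).trans p.2.2⟩

/-- The action `[z, w] [ζ] = [z ζ, w ζ⁻¹]` of `T^n = T^N / K` on `X(α, β)`. -/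
instance (α : Module.Dual ℝ K.lie) (β : K.lie →ₗ[ℝ] ℂ) :
    MulAction K.quotientTorus (X K α β) where
  smul g x := Quotient.liftOn₂ g x (fun ζ p => X.mk K (actLevel K ζ p)) (by
    intro ζ p ζ' p' hζ hp
    obtain ⟨κ, hκ, h⟩ := hp
    refine Quotient.sound ⟨(ζ⁻¹ * ζ') * κ, mul_mem (QuotientGroup.leftRel_apply.1 hζ) hκ, ?_⟩
    change act _ (act ζ p.1) = act ζ' p'.1
    rw [← h, ← act_mul, ← act_mul]
    congr 1
    rw [mul_right_comm, mul_right_comm ζ⁻¹, inv_mul_cancel, one_mul])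
  one_smul x := by
    induction x using Quotient.inductionOn with | _ p => ?_
    exact congrArg (X.mk K) (Subtype.ext (act_one p.1))
  mul_smul g h x := by
    induction g using Quotient.inductionOn with | _ ζ => ?_
    induction h using Quotient.inductionOn with | _ η => ?_
    induction x using Quotient.inductionOn with | _ p => ?_
    exact congrArg (X.mk K) (Subtype.ext (act_mul ζ η p.1))

lemma smul_mk {α : Module.Dual ℝ K.lie} {β : K.lie →ₗ[ℝ] ℂ} (ζ : Fin N → Circle)
    (p : levelSet K α β) :
    (QuotientGroup.mk ζ : K.quotientTorus) • X.mk K p = X.mk K (actLevel K ζ p) := rfl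

/-- The point `[0, 0]` of `X(0, 0)`. -/
def origin : X K 0 0 := X.mk K ⟨0, by simp [levelSet, mu1, muC]⟩

/-! ### GIT quotients -/

/-- The `K_ℂ`-orbit through a point of `ℍ^N`. -/
def orbitC (p : HSpace N) : Set (HSpace N) := {q | ∃ ζ ∈ K.complexification, actC ζ p = q}

/-- The set `μ_ℂ⁻¹(β)^{α-ss}` of `α`-semi-stable points, for arbitrary `α ∈ k^*`: those with
`α ∈ ∑ ℝ_{≥ 0} |z_i|² ι^* u_i + ∑ ℝ_{≥ 0} |w_i|² (-ι^* u_i)`. -/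
def semistable (α : Module.Dual ℝ K.lie) (β : K.lie →ₗ[ℝ] ℂ) : Set (HSpace N) :=
  {p | muC K p = β ∧ ∃ a b : Fin N → ℝ, (∀ i, 0 ≤ a i) ∧ (∀ i, 0 ≤ b i) ∧
    α = ∑ i, (a i * ‖p.1 i‖ ^ 2) • K.u i + ∑ i, (b i * ‖p.2 i‖ ^ 2) • (-K.u i)}

/-- The (underlying set of the) categorical quotient `μ_ℂ⁻¹(β)^{α-ss} // K_ℂ`: semi-stable points
are identified when the closures of their `K_ℂ`-orbits in `μ_ℂ⁻¹(β)^{α-ss}` intersect. -/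
def GIT (α : Module.Dual ℝ K.lie) (β : K.lie →ₗ[ℝ] ℂ) : Type :=
  Quot fun p q : semistable K α β =>
    (closure (orbitC K p.1) ∩ closure (orbitC K q.1) ∩ semistable K α β).Nonempty

lemma levelSet_subset_semistable (α : Module.Dual ℝ K.lie) (β : K.lie →ₗ[ℝ] ℂ) :
    levelSet K α β ⊆ semistable K α β := by
  rintro p ⟨h1, h2⟩
  refine ⟨h2, fun _ => Real.pi, fun _ => Real.pi, fun _ => Real.pi_pos.le,
    fun _ => Real.pi_pos.le, ?_⟩
  rw [← h1, mu1, ← Finset.sum_add_distrib, Finset.smul_sum]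
  refine Finset.sum_congr rfl fun i _ => ?_
  module

lemma mem_semistable_zero {β : K.lie →ₗ[ℝ] ℂ} {p : HSpace N} (h : muC K p = β) :
    p ∈ semistable K 0 β :=
  ⟨h, 0, 0, fun _ => le_rfl, fun _ => le_rfl, by simp⟩

lemma mem_orbitC_self (p : HSpace N) : p ∈ orbitC K p := ⟨1, one_mem _, actC_one p⟩

lemma act_mem_orbitC {κ : Fin N → Circle} (hκ : κ ∈ K.toSubgroup) (p : HSpace N) :
    act κ p ∈ orbitC K p :=
  ⟨toComplexTorus κ, ⟨κ, hκ, 0, zero_mem _, by rw [expI_zero, mul_one]⟩, rfl⟩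

/-- The natural map `X(α, β) → μ_ℂ⁻¹(β)^{α-ss} // K_ℂ`, induced by
`μ⁻¹(α, β) ⊂ μ_ℂ⁻¹(β)^{α-ss}`. -/
def toGIT (α : Module.Dual ℝ K.lie) (β : K.lie →ₗ[ℝ] ℂ) : X K α β → GIT K α β :=
  Quotient.lift (fun p => Quot.mk _ ⟨p.1, levelSet_subset_semistable K α β p.2⟩) (by
    rintro p q ⟨κ, hκ, h⟩
    refine Quot.sound ⟨q.1, ⟨subset_closure (h ▸ act_mem_orbitC K hκ p.1),
      subset_closure (mem_orbitC_self K q.1)⟩, levelSet_subset_semistable K α β q.2⟩)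

/-- The map `μ_ℂ⁻¹(β)^{α-ss} // K_ℂ → μ_ℂ⁻¹(β) // K_ℂ` induced by the inclusion
`μ_ℂ⁻¹(β)^{α-ss} ⊂ μ_ℂ⁻¹(β) = μ_ℂ⁻¹(β)^{0-ss}`. -/
def gitMap (α : Module.Dual ℝ K.lie) (β : K.lie →ₗ[ℝ] ℂ) : GIT K α β → GIT K 0 β :=
  Quot.lift (fun p => Quot.mk _ ⟨p.1, mem_semistable_zero K p.2.1⟩) (by
    rintro p q ⟨r, hr, hr'⟩
    exact Quot.sound ⟨r, hr, mem_semistable_zero K hr'.1⟩)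

/-! ### The identification of `X(0, β)` with the affine quotient

The facts up to `gitEquiv` show that `toGIT K 0 β` is a bijection, which is what is needed to
regard the map of GIT quotients as a map `X(α, β) → X(0, β)`. -/

/-- The squared Euclidean norm on `ℍ^N`. -/
def nsq (p : HSpace N) : ℝ := ∑ i, (‖p.1 i‖ ^ 2 + ‖p.2 i‖ ^ 2)

lemma continuous_nsq : Continuous (nsq (N := N)) := by unfold nsq; fun_prop

lemma continuous_actC (ζ : Fin N → ℂˣ) : Continuous (actC ζ) := by unfold actC; fun_prop

lemma norm_expI (Y : Fin N → ℝ) (i : Fin N) :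
    ‖(expI Y i : ℂ)‖ = Real.exp (-(2 * Real.pi * Y i)) := by
  simp only [expI, Units.val_mk0, Complex.norm_exp]
  congr 1
  simp

lemma expI_val (Y : Fin N → ℝ) (i : Fin N) :
    (expI Y i : ℂ) = (Real.exp (-(2 * Real.pi * Y i)) : ℝ) := by
  simp only [expI, Units.val_mk0, Complex.ofReal_exp]
  congr 1
  push_cast
  linear_combination (2 * Real.pi * Y i : ℂ) * Complex.I_mul_I

lemma actC_norm_fst (κ : Fin N → Circle) (Y : Fin N → ℝ) (p : HSpace N) (i : Fin N) :
    ‖(actC (toComplexTorus κ * expI Y) p).1 i‖ = ‖p.1 i‖ * Real.exp (-(2 * Real.pi * Y i)) := by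
  simp [actC, norm_toComplexTorus, norm_expI]

lemma actC_norm_snd (κ : Fin N → Circle) (Y : Fin N → ℝ) (p : HSpace N) (i : Fin N) :
    ‖(actC (toComplexTorus κ * expI Y) p).2 i‖ = ‖p.2 i‖ * Real.exp (2 * Real.pi * Y i) := by
  simp [actC, norm_toComplexTorus, norm_expI, Real.exp_neg]

lemma actC_mem_closure {p q : HSpace N} (hq : q ∈ closure (orbitC K p)) {ζ : Fin N → ℂˣ}
    (hζ : ζ ∈ K.complexification) : actC ζ q ∈ closure (orbitC K p) := by
  refine map_mem_closure (continuous_actC ζ) hq ?_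
  rintro _ ⟨η, hη, rfl⟩
  exact ⟨ζ * η, mul_mem hζ hη, actC_mul _ _ _⟩

lemma closure_orbitC_subset {p q : HSpace N} (hq : q ∈ closure (orbitC K p)) :
    closure (orbitC K q) ⊆ closure (orbitC K p) := by
  refine closure_minimal ?_ isClosed_closure
  rintro _ ⟨ζ, hζ, rfl⟩
  exact actC_mem_closure K hq hζ

lemma muC_of_mem_closure {p q : HSpace N} (hq : q ∈ closure (orbitC K p)) :
    muC K q = muC K p := by
  ext Y
  have hc : Continuous fun r : HSpace N => muC K r Y := by
    simp only [muC, LinearMap.smul_apply, LinearMap.sum_apply, LinearMap.smulRight_apply]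
    fun_prop
  have hcl : IsClosed {r : HSpace N | muC K r Y = muC K p Y} := isClosed_eq hc continuous_const
  refine closure_minimal ?_ hcl hq
  rintro _ ⟨ζ, -, rfl⟩
  exact congrArg (fun f => f Y) (muC_actC K ζ p)

lemma mu1_eq_zero_iff (p : HSpace N) :
    mu1 K p = 0 ↔ ∀ Y ∈ K.lie, ∑ i, (‖p.1 i‖ ^ 2 - ‖p.2 i‖ ^ 2) * Y i = 0 := by
  rw [mu1, smul_eq_zero_iff_right Real.pi_ne_zero, LinearMap.ext_iff]
  simp [Subtorus.u]

/-- A point of minimal norm in the closure of a `K_ℂ`-orbit is a zero of `μ₁`. -/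
lemma exists_mu1_zero (p : HSpace N) : ∃ q ∈ closure (orbitC K p), mu1 K q = 0 := by
  have hp : p ∈ closure (orbitC K p) := subset_closure (mem_orbitC_self K p)
  have hbd : Bornology.IsBounded {r : HSpace N | nsq r ≤ nsq p} := by
    refine (Metric.isBounded_closedBall (x := (0 : HSpace N)) (r := √(nsq p))).subset ?_
    intro r hr
    have h1 : ∀ i, ‖r.1 i‖ ^ 2 + ‖r.2 i‖ ^ 2 ≤ nsq p := fun i =>
      (Finset.single_le_sum (f := fun i => ‖r.1 i‖ ^ 2 + ‖r.2 i‖ ^ 2)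
        (fun i _ => by positivity) (Finset.mem_univ i)).trans hr
    rw [mem_closedBall_zero_iff, Prod.norm_def]
    refine max_le ?_ ?_ <;> rw [pi_norm_le_iff_of_nonneg (Real.sqrt_nonneg _)] <;> intro i <;>
      refine Real.le_sqrt_of_sq_le ?_ <;> nlinarith [h1 i, sq_nonneg ‖r.1 i‖, sq_nonneg ‖r.2 i‖]
  have hcpt : IsCompact (closure (orbitC K p) ∩ {r | nsq r ≤ nsq p}) :=
    Metric.isCompact_of_isClosed_isBounded
      (isClosed_closure.inter (isClosed_le continuous_nsq continuous_const))
      (hbd.subset Set.inter_subset_right)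
  obtain ⟨q, hq, hmin⟩ := hcpt.exists_isMinOn ⟨p, hp, le_refl (nsq p)⟩ continuous_nsq.continuousOn
  refine ⟨q, hq.1, (mu1_eq_zero_iff K q).2 fun Y hY => ?_⟩
  have hmin' : ∀ r ∈ closure (orbitC K p), nsq q ≤ nsq r := by
    intro r hr
    by_cases h : nsq r ≤ nsq p
    · exact hmin ⟨hr, h⟩
    · exact (show nsq q ≤ nsq p from hq.2).trans (not_le.1 h).le
  let g : ℝ → ℝ := fun t => ∑ i, (‖q.1 i‖ ^ 2 * Real.exp (t * (-(4 * Real.pi * Y i))) +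
    ‖q.2 i‖ ^ 2 * Real.exp (t * (4 * Real.pi * Y i)))
  have hg : ∀ t, g t = nsq (actC (toComplexTorus 1 * expI (t • Y)) q) := by
    intro t
    refine Finset.sum_congr rfl fun i _ => ?_
    rw [actC_norm_fst, actC_norm_snd, mul_pow, mul_pow, ← Real.exp_nat_mul, ← Real.exp_nat_mul]
    simp only [Pi.smul_apply, smul_eq_mul]
    congr 3 <;> push_cast <;> ring
  have hg0 : g 0 = nsq q := by simp [g, nsq]
  have hloc : IsLocalMin g 0 := Eventually.of_forall fun t => by
    rw [hg0, hg t]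
    exact hmin' _ (actC_mem_closure K hq.1 ⟨1, one_mem _, t • Y, K.lie.smul_mem t hY, rfl⟩)
  have hder : HasDerivAt g (∑ i, (‖q.1 i‖ ^ 2 * (Real.exp (0 * (-(4 * Real.pi * Y i))) *
      (1 * (-(4 * Real.pi * Y i)))) +
      ‖q.2 i‖ ^ 2 * (Real.exp (0 * (4 * Real.pi * Y i)) * (1 * (4 * Real.pi * Y i))))) 0 := by
    refine HasDerivAt.fun_sum fun i _ => ?_
    exact ((((hasDerivAt_id' (0 : ℝ)).mul_const _).exp.const_mul _).add
      (((hasDerivAt_id' (0 : ℝ)).mul_const _).exp.const_mul _))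
  have h0 := hloc.hasDerivAt_eq_zero hder
  have h1 : (-(4 * Real.pi)) * ∑ i, (‖q.1 i‖ ^ 2 - ‖q.2 i‖ ^ 2) * Y i = 0 := by
    rw [← h0, Finset.mul_sum]
    refine Finset.sum_congr rfl fun i _ => ?_
    simp only [zero_mul, Real.exp_zero]
    ring
  exact (mul_eq_zero.1 h1).resolve_left (by simp [Real.pi_ne_zero])

lemma mul_log_le {a x : ℝ} (ha : 0 ≤ a) (hx : 0 ≤ x) (h : a ≠ 0 → x ≠ 0) :
    a * Real.log x - a * Real.log a ≤ x - a := by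
  rcases ha.eq_or_lt with rfl | ha
  · simpa using hx
  · have hx' : 0 < x := lt_of_le_of_ne hx (h ha.ne').symm
    have := Real.log_le_sub_one_of_pos (div_pos hx' ha)
    rw [Real.log_div hx'.ne' ha.ne'] at this
    have h2 := mul_le_mul_of_nonneg_left this ha.le
    have h3 : a * (x / a - 1) = x - a := by field_simp
    linarith

/-- A zero of `μ₁` in the closure of a `K_ℂ`-orbit has minimal norm there. -/
lemma nsq_le_of_mu1_zero {p q r : HSpace N} (hq : q ∈ closure (orbitC K p)) (h : mu1 K q = 0)
    (hr : r ∈ orbitC K p) : nsq q ≤ nsq r := by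
  have hz1 : ∀ i, p.1 i = 0 → q.1 i = 0 := fun i hi => by
    have hcl : IsClosed {s : HSpace N | s.1 i = 0} := isClosed_eq (by fun_prop) continuous_const
    refine closure_minimal ?_ hcl hq
    rintro _ ⟨ζ, -, rfl⟩
    simp [actC, hi]
  have hz2 : ∀ i, p.2 i = 0 → q.2 i = 0 := fun i hi => by
    have hcl : IsClosed {s : HSpace N | s.2 i = 0} := isClosed_eq (by fun_prop) continuous_const
    refine closure_minimal ?_ hcl hq
    rintro _ ⟨ζ, -, rfl⟩
    simp [actC, hi]
  let L : HSpace N → ℝ := fun s => ∑ i, (‖q.1 i‖ ^ 2 * Real.log (‖s.1 i‖ ^ 2) +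
    ‖q.2 i‖ ^ 2 * Real.log (‖s.2 i‖ ^ 2))
  have hconst : ∀ s ∈ orbitC K p, L s = L p := by
    rintro _ ⟨_, ⟨κ, hκ, Y, hY, rfl⟩, rfl⟩
    have hY0 := (mu1_eq_zero_iff K q).1 h Y hY
    have : L (actC (toComplexTorus κ * expI Y) p) - L p =
        (-(4 * Real.pi)) * ∑ i, (‖q.1 i‖ ^ 2 - ‖q.2 i‖ ^ 2) * Y i := by
      simp only [L]
      rw [← Finset.sum_sub_distrib, Finset.mul_sum]
      refine Finset.sum_congr rfl fun i _ => ?_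
      rw [actC_norm_fst, actC_norm_snd]
      have e1 : ‖q.1 i‖ ^ 2 * Real.log ((‖p.1 i‖ * Real.exp (-(2 * Real.pi * Y i))) ^ 2) =
          ‖q.1 i‖ ^ 2 * (Real.log (‖p.1 i‖ ^ 2) - 4 * Real.pi * Y i) := by
        by_cases hp : p.1 i = 0
        · simp [hz1 i hp]
        · have : ‖p.1 i‖ ≠ 0 := norm_ne_zero_iff.2 hp
          rw [Real.log_pow, Real.log_mul this (Real.exp_ne_zero _), Real.log_exp, Real.log_pow]
          push_cast
          ring
      have e2 : ‖q.2 i‖ ^ 2 * Real.log ((‖p.2 i‖ * Real.exp (2 * Real.pi * Y i)) ^ 2) =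
          ‖q.2 i‖ ^ 2 * (Real.log (‖p.2 i‖ ^ 2) + 4 * Real.pi * Y i) := by
        by_cases hp : p.2 i = 0
        · simp [hz2 i hp]
        · have : ‖p.2 i‖ ≠ 0 := norm_ne_zero_iff.2 hp
          rw [Real.log_pow, Real.log_mul this (Real.exp_ne_zero _), Real.log_exp, Real.log_pow]
          push_cast
          ring
      rw [e1, e2]
      ring
    rw [hY0, mul_zero] at this
    linarith
  have hcont : ContinuousAt L q := by
    refine tendsto_finsetSum _ fun i _ => Tendsto.add ?_ ?_
    · by_cases hi : q.1 i = 0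
      · simp [hi]
      · exact Tendsto.const_mul _ (ContinuousAt.log (by fun_prop) (by simpa using hi))
    · by_cases hi : q.2 i = 0
      · simp [hi]
      · exact Tendsto.const_mul _ (ContinuousAt.log (by fun_prop) (by simpa using hi))
  have hLq : L q = L p := by
    have : (𝓝[orbitC K p] q).NeBot := mem_closure_iff_nhdsWithin_neBot.1 hq
    refine tendsto_nhds_unique (hcont.mono_left nhdsWithin_le_nhds : Tendsto L (𝓝[orbitC K p] q) _)
      (tendsto_const_nhds.congr' ?_)
    filter_upwards [self_mem_nhdsWithin] with s hs using (hconst s hs).symm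
  have hsum : L r - L q ≤ nsq r - nsq q := by
    simp only [L, nsq]
    rw [← Finset.sum_sub_distrib, ← Finset.sum_sub_distrib]
    refine Finset.sum_le_sum fun i _ => ?_
    have hr1 : q.1 i ≠ 0 → r.1 i ≠ 0 := by
      obtain ⟨ζ, -, rfl⟩ := hr
      intro hqi
      simp [actC, mt (hz1 i) hqi]
    have hr2 : q.2 i ≠ 0 → r.2 i ≠ 0 := by
      obtain ⟨ζ, -, rfl⟩ := hr
      intro hqi
      simp [actC, mt (hz2 i) hqi]
    have l1 := mul_log_le (a := ‖q.1 i‖ ^ 2) (x := ‖r.1 i‖ ^ 2) (by positivity) (by positivity)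
      (by simpa using hr1)
    have l2 := mul_log_le (a := ‖q.2 i‖ ^ 2) (x := ‖r.2 i‖ ^ 2) (by positivity) (by positivity)
      (by simpa using hr2)
    linarith
  rw [hconst r hr, hLq] at hsum
  linarith

lemma compl_eq_of_norm {a b c : ℂ} (ha : a * star c = ‖a‖ * ‖c‖) (hb : b * star c = ‖b‖ * ‖c‖)
    (hab : ‖a‖ = ‖b‖) (h0 : c = 0 → a = 0) : a = b := by
  by_cases hc : c = 0
  · have := h0 hc
    rw [this, norm_zero] at hab
    rw [this, norm_eq_zero.1 hab.symm]
  · have : star c ≠ 0 := by simpa using hc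
    exact mul_right_cancel₀ this (by rw [ha, hb, hab])

/-- Some `K`-translate of a point in the closure of a `K_ℂ`-orbit has the phases of the base
point. -/
lemma exists_phase {p q : HSpace N} (hq : q ∈ closure (orbitC K p)) : ∃ κ ∈ K.toSubgroup,
    (∀ i, (act κ q).1 i * star (p.1 i) = ‖(act κ q).1 i‖ * ‖p.1 i‖) ∧
    (∀ i, (act κ q).2 i * star (p.2 i) = ‖(act κ q).2 i‖ * ‖p.2 i‖) ∧
    (∀ i, p.1 i = 0 → (act κ q).1 i = 0) ∧ (∀ i, p.2 i = 0 → (act κ q).2 i = 0) := by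
  let D : Set (HSpace N) := {s |
    (∀ i, s.1 i * star (p.1 i) = ‖s.1 i‖ * ‖p.1 i‖) ∧
    (∀ i, s.2 i * star (p.2 i) = ‖s.2 i‖ * ‖p.2 i‖) ∧
    (∀ i, p.1 i = 0 → s.1 i = 0) ∧ (∀ i, p.2 i = 0 → s.2 i = 0)}
  have hD : IsClosed D := by
    simp only [D, Set.ofPred_and, Set.ofPred_forall]
    refine IsClosed.inter ?_ (IsClosed.inter ?_ (IsClosed.inter ?_ ?_))
    · exact isClosed_iInter fun i => isClosed_eq (by fun_prop) (by fun_prop)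
    · exact isClosed_iInter fun i => isClosed_eq (by fun_prop) (by fun_prop)
    · exact isClosed_iInter fun i => isClosed_iInter fun _ => isClosed_eq (by fun_prop) (by fun_prop)
    · exact isClosed_iInter fun i => isClosed_iInter fun _ => isClosed_eq (by fun_prop) (by fun_prop)
  let S : Set ((Fin N → Circle) × HSpace N) := {x | x.1 ∈ K.toSubgroup ∧ act x.1 x.2 ∈ D}
  have hact : Continuous fun x : (Fin N → Circle) × HSpace N => act x.1 x.2 := by
    have e : (fun x : (Fin N → Circle) × HSpace N => act x.1 x.2) = fun x =>
        (fun i => x.2.1 i * ((x.1 i : Circle) : ℂ),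
          fun i => x.2.2 i * (((x.1 i)⁻¹ : Circle) : ℂ)) := by
      funext x
      refine Prod.ext ?_ ?_ <;> funext i <;> simp [act, actC, toComplexTorus]
    rw [e]
    fun_prop
  have hS : IsClosed S :=
    (K.isClosed'.preimage continuous_fst).inter (hD.preimage hact)
  have hcl : IsClosed (Prod.snd '' S) := isClosedMap_snd_of_compactSpace _ hS
  have hsub : orbitC K p ⊆ Prod.snd '' S := by
    rintro _ ⟨_, ⟨κ, hκ, Y, hY, rfl⟩, rfl⟩
    refine ⟨(κ⁻¹, _), ⟨inv_mem hκ, ?_⟩, rfl⟩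
    have e : act κ⁻¹ (actC (toComplexTorus κ * expI Y) p) = actC (expI Y) p := by
      rw [act, ← actC_mul, ← mul_assoc, ← map_mul, inv_mul_cancel, map_one, one_mul]
    change act κ⁻¹ (actC (toComplexTorus κ * expI Y) p) ∈ D
    rw [e]
    have key : ∀ (c : ℂ) (t : ℝ), 0 ≤ t → c * (t : ℂ) * star c = ‖c * (t : ℂ)‖ * ‖c‖ := by
      intro c t ht
      rw [norm_mul, Complex.norm_real, Real.norm_of_nonneg ht]
      have : c * star c = (‖c‖ : ℂ) ^ 2 := by
        simpa using Complex.mul_conj' c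
      push_cast
      linear_combination (t : ℂ) * this
    refine ⟨fun i => ?_, fun i => ?_, fun i hi => ?_, fun i hi => ?_⟩
    · simp only [actC, expI_val]
      exact key _ _ (Real.exp_pos _).le
    · simp only [actC, Units.val_inv_eq_inv_val, expI_val, ← Complex.ofReal_inv]
      exact key _ _ (inv_nonneg.2 (Real.exp_pos _).le)
    · simp [actC, hi]
    · simp [actC, hi]
  obtain ⟨⟨κ, r⟩, ⟨hκ, hd⟩, rfl⟩ := closure_minimal hsub hcl hq
  exact ⟨κ, hκ, hd⟩

lemma norm_act_fst (κ : Fin N → Circle) (p : HSpace N) (i : Fin N) :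
    ‖(act κ p).1 i‖ = ‖p.1 i‖ := by
  simp [act, actC, norm_toComplexTorus]

lemma norm_act_snd (κ : Fin N → Circle) (p : HSpace N) (i : Fin N) :
    ‖(act κ p).2 i‖ = ‖p.2 i‖ := by
  simp [act, actC, norm_toComplexTorus]

/-- The zeros of `μ₁` in the closure of a `K_ℂ`-orbit form at most one `K`-orbit. -/
lemma unique_mu1_zero {p q q' : HSpace N} (hq : q ∈ closure (orbitC K p))
    (hq' : q' ∈ closure (orbitC K p)) (h : mu1 K q = 0) (h' : mu1 K q' = 0) :
    ∃ κ ∈ K.toSubgroup, act κ q = q' := by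
  have hle : ∀ {a b : HSpace N}, a ∈ closure (orbitC K p) → b ∈ closure (orbitC K p) →
      mu1 K a = 0 → nsq a ≤ nsq b := by
    intro a b ha hb h0
    have hcl : IsClosed {s : HSpace N | nsq a ≤ nsq s} :=
      isClosed_le continuous_const continuous_nsq
    exact closure_minimal (fun s hs => nsq_le_of_mu1_zero K ha h0 hs) hcl hb
  have heq : nsq q = nsq q' := le_antisymm (hle hq hq' h) (hle hq' hq h')
  have hmid : nsq q ≤ ∑ i, (‖q.1 i‖ * ‖q'.1 i‖ + ‖q.2 i‖ * ‖q'.2 i‖) := by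
    let C : Set (HSpace N × HSpace N) :=
      {x | nsq q ≤ ∑ i, (‖x.1.1 i‖ * ‖x.2.1 i‖ + ‖x.1.2 i‖ * ‖x.2.2 i‖)}
    have hC : IsClosed C := isClosed_le continuous_const (by fun_prop)
    have hsub : orbitC K p ×ˢ orbitC K p ⊆ C := by
      rintro ⟨_, _⟩ ⟨⟨_, ⟨κ, hκ, Y, hY, rfl⟩, rfl⟩, ⟨_, ⟨κ', hκ', Y', hY', rfl⟩, rfl⟩⟩
      have hs := nsq_le_of_mu1_zero K hq h (r := actC (toComplexTorus 1 *
        expI ((1 / 2 : ℝ) • (Y + Y'))) p) ⟨_, ⟨1, one_mem _, _,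
          K.lie.smul_mem _ (add_mem hY hY'), rfl⟩, rfl⟩
      refine hs.trans (le_of_eq (Finset.sum_congr rfl fun i _ => ?_))
      simp only [actC_norm_fst, actC_norm_snd, Pi.smul_apply, Pi.add_apply, smul_eq_mul]
      have e1 : ∀ a b : ℝ, Real.exp a * Real.exp b = Real.exp ((a + b) / 2) ^ 2 := fun a b => by
        rw [← Real.exp_add, ← Real.exp_nat_mul]; congr 1; push_cast; ring
      rw [mul_mul_mul_comm ‖p.1 i‖, mul_mul_mul_comm ‖p.2 i‖, e1, e1, mul_pow, mul_pow, ← sq, ← sq]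
      congr 4 <;> ring
    have : (q, q') ∈ closure (orbitC K p ×ˢ orbitC K p) := by
      rw [closure_prod_eq]; exact ⟨hq, hq'⟩
    exact closure_minimal hsub hC this
  have hsq : ∑ i, ((‖q.1 i‖ - ‖q'.1 i‖) ^ 2 + (‖q.2 i‖ - ‖q'.2 i‖) ^ 2) ≤ 0 := by
    have e : ∑ i, ((‖q.1 i‖ - ‖q'.1 i‖) ^ 2 + (‖q.2 i‖ - ‖q'.2 i‖) ^ 2) =
        nsq q + nsq q' - 2 * ∑ i, (‖q.1 i‖ * ‖q'.1 i‖ + ‖q.2 i‖ * ‖q'.2 i‖) := by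
      simp only [nsq]
      rw [← Finset.sum_add_distrib, Finset.mul_sum, ← Finset.sum_sub_distrib]
      exact Finset.sum_congr rfl fun i _ => by ring
    rw [e]
    linarith
  have hz := (Finset.sum_eq_zero_iff_of_nonneg (fun i _ => by positivity)).1
    (le_antisymm hsq (Finset.sum_nonneg fun i _ => by positivity))
  have hn1 : ∀ i, ‖q.1 i‖ = ‖q'.1 i‖ := fun i => by
    have := hz i (Finset.mem_univ i)
    nlinarith [sq_nonneg (‖q.1 i‖ - ‖q'.1 i‖), sq_nonneg (‖q.2 i‖ - ‖q'.2 i‖)]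
  have hn2 : ∀ i, ‖q.2 i‖ = ‖q'.2 i‖ := fun i => by
    have := hz i (Finset.mem_univ i)
    nlinarith [sq_nonneg (‖q.1 i‖ - ‖q'.1 i‖), sq_nonneg (‖q.2 i‖ - ‖q'.2 i‖)]
  obtain ⟨κ, hκ, a1, a2, a3, a4⟩ := exists_phase K hq
  obtain ⟨κ', hκ', b1, b2, b3, b4⟩ := exists_phase K hq'
  have e : act κ q = act κ' q' := by
    refine Prod.ext ?_ ?_ <;> funext i
    · exact compl_eq_of_norm (a1 i) (b1 i) (by rw [norm_act_fst, norm_act_fst, hn1]) (a3 i)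
    · exact compl_eq_of_norm (a2 i) (b2 i) (by rw [norm_act_snd, norm_act_snd, hn2]) (a4 i)
  exact ⟨κ'⁻¹ * κ, mul_mem (inv_mem hκ') hκ, by
    rw [act_mul, e, ← act_mul, inv_mul_cancel, act_one]⟩

lemma toGIT_zero_bijective (β : K.lie →ₗ[ℝ] ℂ) : Function.Bijective (toGIT K 0 β) := by
  choose f hf hf0 using exists_mu1_zero K
  have hfl : ∀ p, muC K p = β → f p ∈ levelSet K 0 β := fun p hp =>
    ⟨hf0 p, (muC_of_mem_closure K (hf p)).trans hp⟩
  let Φ : GIT K 0 β → X K 0 β := Quot.lift (fun p => X.mk K ⟨f p.1, hfl p.1 p.2.1⟩) (by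
    rintro p q ⟨r, ⟨hrp, hrq⟩, hr⟩
    have h1 : X.mk K ⟨f p.1, hfl p.1 p.2.1⟩ = X.mk K ⟨f r, hfl r hr.1⟩ := Quotient.sound
      (unique_mu1_zero K (hf p.1) (closure_orbitC_subset K hrp (hf r)) (hf0 _) (hf0 _))
    have h2 : X.mk K ⟨f q.1, hfl q.1 q.2.1⟩ = X.mk K ⟨f r, hfl r hr.1⟩ := Quotient.sound
      (unique_mu1_zero K (hf q.1) (closure_orbitC_subset K hrq (hf r)) (hf0 _) (hf0 _))
    exact h1.trans h2.symm)
  refine Function.bijective_iff_has_inverse.2 ⟨Φ, fun x => ?_, fun y => ?_⟩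
  · induction x using Quotient.inductionOn with | _ p => ?_
    exact Quotient.sound (unique_mu1_zero K (hf p.1) (subset_closure (mem_orbitC_self K p.1))
      (hf0 _) p.2.1)
  · induction y using Quot.inductionOn with | _ p => ?_
    exact Quot.sound ⟨f p.1, ⟨subset_closure (mem_orbitC_self K _), hf p.1⟩,
      mem_semistable_zero K (hfl p.1 p.2.1).2⟩

/-- The identification of `X(0, β)` with the affine quotient `μ_ℂ⁻¹(β) // K_ℂ`. -/
def gitEquiv (β : K.lie →ₗ[ℝ] ℂ) : X K 0 β ≃ GIT K 0 β :=
  Equiv.ofBijective (toGIT K 0 β) (toGIT_zero_bijective K β)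

/-- The natural morphism `π₁ : X(α, β) → X(0, β)`: the map of GIT quotients induced by the
inclusion `μ_ℂ⁻¹(β)^{α-ss} ⊂ μ_ℂ⁻¹(β)`. -/
def naturalMorphism (α : Module.Dual ℝ K.lie) (β : K.lie →ₗ[ℝ] ℂ) (x : X K α β) : X K 0 β :=
  (gitEquiv K β).symm (gitMap K α β (toGIT K α β x))

/-! ### Toric subvarieties -/

/-- `V_ε`: the points with `w_i = 0` if `ε(i) = 1`, and `z_i = 0` if `ε(i) = -1`. -/
def V (ε : Fin N → ℤˣ) : Set (HSpace N) :=
  {p | ∀ i, (ε i = 1 → p.2 i = 0) ∧ (ε i = -1 → p.1 i = 0)}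

/-- `M_ε(α) = (V_ε ∩ μ₁⁻¹(α)) / K ⊂ X(α, 0)`; note that `μ_ℂ = 0` on `V_ε`. -/
def M (α : Module.Dual ℝ K.lie) (ε : Fin N → ℤˣ) : Set (X K α 0) :=
  X.mk K '' {p | p.1 ∈ V ε}

/-- `Θ_cpt(α)`: the set of all `ε` such that `M_ε(α)` is compact. -/
def compactSigns (α : Module.Dual ℝ K.lie) : Set (Fin N → ℤˣ) := {ε | IsCompact (M K α ε)}

end

/-- `A` is a `G`-equivariant (strong) deformation retract of the `G`-space `Y`: there is a
`G`-equivariant homotopy, fixing `A` pointwise, from the identity of `Y` to a map into `A`. -/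
def IsEquivariantDeformationRetract (G : Type*) {Y : Type*} [SMul G Y] [TopologicalSpace Y]
    (A : Set Y) : Prop :=
  ∃ H : C(unitInterval × Y, Y),
    (∀ y, H (0, y) = y) ∧ (∀ y, H (1, y) ∈ A) ∧ (∀ t, ∀ a ∈ A, H (t, a) = a) ∧
      ∀ t (g : G) y, H (t, g • y) = g • H (t, y)

end ToricHK

namespace ToricHK

/-! ### Gordan's alternative and minimal points -/

section Polyhedral

variable {ι : Type*} [Fintype ι]

/-! The proof reduces both claims to polyhedral geometry in the squared moduli $a_i=|z_i|^2$,
$b_i=|w_i|^2$. A point of `X K α 0` lies over the origin exactly when $0$ is in the closure of its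
$K_{\mathbb C}$-orbit, and this holds exactly when some $Y\in k$ is positive where $z_i\ne0$ and
negative where $w_i\ne0$ (`IsNilpotent`).

For the retraction, $\mu_1$ sees only $y=a-b$ modulo $k^\perp$. Take the $e\in k^\perp$ with $-a\le
e\le b$ that makes $|y+e|$ smallest. It is unique, continuous in the point, and invariant under the
torus. Keep the phases of $z_i$ and $w_i$, move $a_i-b_i$ along $y_i+te_i$ and let $a_ib_i$ shrink
by the factor $1-t$. Then $\mu_1$ does not change and $\mu_{\mathbb C}$ is multiplied by
$\sqrt{1-t}$, so it stays $0$. The bounds on $e$ ensure that no modulus grows, which gives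
continuity where a coordinate vanishes. At $t=1$ one of $z_i,w_i$ is zero, and minimality together
with Gordan's alternative (`gordan`) yields $Y\in k$ with the signs of $y+e$
(`IsMinShift.exists_sign`), so the end point is nilpotent. At a nilpotent point the only admissible
$e$ is $0$ and $a_ib_i=0$ already, so the point stays fixed.

For the union, a nilpotent point admits a $Y$ with no zero coordinate once no $\iota^*u_i$ vanishes.
The signs $\epsilon$ of $Y$ give a $V_\epsilon$ containing the point, and pairing $\alpha$ with $Y$
bounds all moduli. Conversely, if no $Y\in k$ has signs $\epsilon$, Gordan's alternative supplies a
direction in $k^\perp$ along which moduli in $V_\epsilon\cap\mu_1^{-1}(\alpha)$ grow without bound.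
-/

/-- The orthogonal complement of a subspace of `ℝ^ι` with respect to the standard dot product. -/
def dotOrthogonal (W : Submodule ℝ (ι → ℝ)) : Submodule ℝ (ι → ℝ) where
  carrier := {l | ∀ Y ∈ W, ∑ i, l i * Y i = 0}
  zero_mem' Y _ := by simp
  add_mem' {l m} hl hm Y hY := by simp [add_mul, Finset.sum_add_distrib, hl Y hY, hm Y hY]
  smul_mem' c l hl Y hY := by simp [mul_assoc, ← Finset.mul_sum, hl Y hY]

lemma mem_dotOrthogonal {W : Submodule ℝ (ι → ℝ)} {l : ι → ℝ} :
    l ∈ dotOrthogonal W ↔ ∀ Y ∈ W, ∑ i, l i * Y i = 0 := Iff.rfl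

lemma isClosed_dotOrthogonal (W : Submodule ℝ (ι → ℝ)) :
    IsClosed (dotOrthogonal W : Set (ι → ℝ)) := by
  have : (dotOrthogonal W : Set (ι → ℝ)) = ⋂ Y ∈ W, {l | ∑ i, l i * Y i = 0} := by
    ext l; simp [mem_dotOrthogonal]
  rw [this]
  exact isClosed_biInter fun Y _ => isClosed_eq (by fun_prop) continuous_const

lemma dual_apply_eq_sum [DecidableEq ι] (f : (ι → ℝ) →ₗ[ℝ] ℝ) (x : ι → ℝ) :
    f x = ∑ i, x i * f (Pi.single i 1) := by
  conv_lhs => rw [pi_eq_sum_univ' x, map_sum]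
  refine Finset.sum_congr rfl fun i _ => ?_
  rw [map_smul, smul_eq_mul]

/-- The double orthogonal of a subspace is the subspace: a functional that kills `W` but not `Y` has
its coefficient vector in the orthogonal complement. -/
lemma mem_of_forall_dotOrthogonal (W : Submodule ℝ (ι → ℝ)) {Y : ι → ℝ}
    (h : ∀ l ∈ dotOrthogonal W, ∑ i, l i * Y i = 0) : Y ∈ W := by
  classical
  by_contra hY
  obtain ⟨f, hf, hW⟩ := Submodule.exists_le_ker_of_notMem hY
  refine hf ?_
  rw [dual_apply_eq_sum, ← h (fun i => f (Pi.single i 1)) fun Z hZ => ?_]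
  · exact Finset.sum_congr rfl fun i _ => mul_comm _ _
  · have := hW hZ
    rw [LinearMap.mem_ker, dual_apply_eq_sum] at this
    rw [← this]
    exact Finset.sum_congr rfl fun i _ => mul_comm _ _

/-- Gordan's alternative, for a subspace and a vector of signs. -/
theorem gordan (W : Submodule ℝ (ι → ℝ)) (s : ι → ℝ) :
    (∃ Y ∈ W, ∀ i, s i ≠ 0 → 0 < s i * Y i) ∨
      ∃ l ∈ dotOrthogonal W, l ≠ 0 ∧ ∀ i, 0 ≤ s i * l i ∧ (s i = 0 → l i = 0) := by
  classical
  -- A slice of the cone of sign-compatible vectors. The normalization makes it compact, so strict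
  -- separation from the orthogonal complement applies, and excludes `0` from a common point.
  let C : Set (ι → ℝ) :=
    {l | (∀ i, 0 ≤ s i * l i ∧ (s i = 0 → l i = 0)) ∧ ∑ i, s i * l i = 1}
  by_cases hd : Disjoint C (dotOrthogonal W : Set (ι → ℝ))
  · left
    have hconv : Convex ℝ C := by
      rintro l ⟨hl, hl'⟩ m ⟨hm, hm'⟩ a b ha hb hab
      refine ⟨fun i => ⟨?_, fun hi => by simp [(hl i).2 hi, (hm i).2 hi]⟩, ?_⟩
      · have := mul_nonneg ha (hl i).1
        have := mul_nonneg hb (hm i).1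
        simp only [Pi.add_apply, Pi.smul_apply, smul_eq_mul]
        nlinarith
      · have : ∑ i, s i * (a • l + b • m) i = a * ∑ i, s i * l i + b * ∑ i, s i * m i := by
          rw [Finset.mul_sum, Finset.mul_sum, ← Finset.sum_add_distrib]
          refine Finset.sum_congr rfl fun i _ => ?_
          simp only [Pi.add_apply, Pi.smul_apply, smul_eq_mul]
          ring
        rw [this, hl', hm']
        linarith
    have hclosed : IsClosed C := by
      simp only [C, Set.ofPred_and, Set.ofPred_forall]
      refine IsClosed.inter ?_ (isClosed_eq (by fun_prop) continuous_const)
      refine isClosed_iInter fun i => IsClosed.inter ?_ ?_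
      · exact isClosed_le continuous_const (by fun_prop)
      · exact isClosed_iInter fun _ => isClosed_eq (by fun_prop) continuous_const
    have hcpt : IsCompact C := by
      refine (isCompact_univ_pi fun i => isCompact_Icc (a := -|(s i)⁻¹|)
        (b := |(s i)⁻¹|)).of_isClosed_subset hclosed ?_
      rintro l ⟨hl, hl'⟩ i -
      rw [Set.mem_Icc, ← abs_le]
      by_cases hi : s i = 0
      · simp [(hl i).2 hi]
      · have h1 : s i * l i ≤ 1 := hl' ▸ Finset.single_le_sum (f := fun i => s i * l i)
          (fun j _ => (hl j).1) (Finset.mem_univ i)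
        have h2 : l i = (s i)⁻¹ * (s i * l i) := by field_simp
        rw [h2, abs_mul, abs_of_nonneg (hl i).1]
        exact mul_le_of_le_one_right (abs_nonneg _) h1
    obtain ⟨f, u, v, hu, huv, hv⟩ := geometric_hahn_banach_compact_closed hconv hcpt
      (dotOrthogonal W).convex (isClosed_dotOrthogonal W) hd
    -- A functional bounded below on a subspace vanishes there: otherwise a multiple of `l` takes
    -- the value `v - 1`.
    have hf0 : ∀ l ∈ dotOrthogonal W, f l = 0 := by
      intro l hl
      by_contra hne
      have := hv (((v - 1) / f l) • l) (Submodule.smul_mem _ _ hl)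
      rw [map_smul, smul_eq_mul, div_mul_cancel₀ _ hne] at this
      linarith
    have hv0 : v < 0 := by simpa using hv 0 (zero_mem _)
    -- On `C` the functional is below `v < 0`; testing it at the points `(s i)⁻¹ • Pi.single i 1` of
    -- `C` gives the signs of its negated coefficients.
    refine ⟨fun i => -f (Pi.single i 1), mem_of_forall_dotOrthogonal W fun l hl => ?_,
      fun i hi => ?_⟩
    · have := hf0 l hl
      rw [← ContinuousLinearMap.coe_coe, dual_apply_eq_sum] at this
      simpa using this
    · have hmem : (s i)⁻¹ • (Pi.single i 1 : ι → ℝ) ∈ C := by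
        refine ⟨fun j => ?_, ?_⟩
        · by_cases hj : j = i
          · subst hj; simp [hi]
          · simp [hj]
        · simp [Pi.single_apply, hi]
      have h1 : (s i)⁻¹ * f (Pi.single i 1) < 0 := by
        have := hu _ hmem
        rw [map_smul, smul_eq_mul] at this
        linarith
      have h2 : s i * -f (Pi.single i 1) = -(s i ^ 2 * ((s i)⁻¹ * f (Pi.single i 1))) := by
        field_simp
      rw [h2, neg_pos]
      exact mul_neg_of_pos_of_neg (by positivity) h1
  · right
    obtain ⟨l, hl, hl'⟩ := Set.not_disjoint_iff.1 hd
    refine ⟨l, hl', ?_, hl.1⟩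
    rintro rfl
    simpa using hl.2

/-- The polytope `{e ∈ W^⊥ : -a ≤ e ≤ b}`. -/
def boxSlice (W : Submodule ℝ (ι → ℝ)) (a b : ι → ℝ) : Set (ι → ℝ) :=
  {e | e ∈ dotOrthogonal W ∧ ∀ i, -a i ≤ e i ∧ e i ≤ b i}

/-- `e` minimizes the Euclidean norm of `a - b + e` among the points of `boxSlice W a b`. -/
def IsMinShift (W : Submodule ℝ (ι → ℝ)) (a b e : ι → ℝ) : Prop :=
  e ∈ boxSlice W a b ∧
    ∀ f ∈ boxSlice W a b, ∑ i, (a i - b i + e i) ^ 2 ≤ ∑ i, (a i - b i + f i) ^ 2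

lemma isCompact_boxSlice (W : Submodule ℝ (ι → ℝ)) (a b : ι → ℝ) :
    IsCompact (boxSlice W a b) := by
  have : boxSlice W a b = (Set.univ.pi fun i => Set.Icc (-a i) (b i)) ∩ dotOrthogonal W := by
    ext e
    simp only [boxSlice, Set.mem_ofPred_eq, Set.mem_inter_iff, Set.mem_pi, Set.mem_univ,
      true_imp_iff, Set.mem_Icc, SetLike.mem_coe]
    exact and_comm
  rw [this]
  exact (isCompact_univ_pi fun i => isCompact_Icc).inter_right (isClosed_dotOrthogonal W)

lemma exists_isMinShift (W : Submodule ℝ (ι → ℝ)) {a b : ι → ℝ} (ha : ∀ i, 0 ≤ a i)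
    (hb : ∀ i, 0 ≤ b i) : ∃ e, IsMinShift W a b e := by
  obtain ⟨e, he, hmin⟩ := (isCompact_boxSlice W a b).exists_isMinOn
    ⟨0, zero_mem _, fun i => ⟨by simpa using ha i, hb i⟩⟩
    (f := fun e => ∑ i, (a i - b i + e i) ^ 2) (by fun_prop)
  exact ⟨e, he, fun f hf => hmin hf⟩

/-- Strict convexity: the midpoint is admissible, and the parallelogram identity would make it
strictly better if the two minimizers differed. -/
lemma IsMinShift.unique {W : Submodule ℝ (ι → ℝ)} {a b e e' : ι → ℝ} (he : IsMinShift W a b e)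
    (he' : IsMinShift W a b e') : e = e' := by
  have hm : (1 / 2 : ℝ) • (e + e') ∈ boxSlice W a b := by
    refine ⟨Submodule.smul_mem _ _ (add_mem he.1.1 he'.1.1), fun i => ?_⟩
    have h1 := he.1.2 i
    have h2 := he'.1.2 i
    simp only [Pi.smul_apply, Pi.add_apply, smul_eq_mul]
    constructor <;> linarith
  have h1 := he.2 _ hm
  have h2 := he'.2 _ hm
  have h3 : ∑ i, (e i - e' i) ^ 2 = 2 * ∑ i, (a i - b i + e i) ^ 2 +
      2 * ∑ i, (a i - b i + e' i) ^ 2 -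
      4 * ∑ i, (a i - b i + ((1 / 2 : ℝ) • (e + e')) i) ^ 2 := by
    simp only [Finset.mul_sum]
    rw [← Finset.sum_add_distrib, ← Finset.sum_sub_distrib]
    refine Finset.sum_congr rfl fun i _ => ?_
    simp only [Pi.smul_apply, Pi.add_apply, smul_eq_mul]
    ring
  have h4 := (Finset.sum_eq_zero_iff_of_nonneg (fun i _ => sq_nonneg (e i - e' i))).1
    (le_antisymm (by linarith) (Finset.sum_nonneg fun i _ => sq_nonneg _))
  funext i
  exact sub_eq_zero.1 (pow_eq_zero_iff two_ne_zero |>.1 (h4 i (Finset.mem_univ i)))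

/-- Minimal shifts depend continuously on the parameters. -/
lemma continuous_of_isMinShift {P : Type*} [TopologicalSpace P] (W : Submodule ℝ (ι → ℝ))
    {a b e : P → ι → ℝ} (ha : Continuous a) (hb : Continuous b) (ha0 : ∀ p i, 0 ≤ a p i)
    (hb0 : ∀ p i, 0 ≤ b p i) (he : ∀ p, IsMinShift W (a p) (b p) (e p)) : Continuous e := by
  refine continuous_iff_continuousAt.2 fun p => ?_
  rw [ContinuousAt, tendsto_iff_ultrafilter]
  -- Near `p` all the boxes lie in one compact box, so `e` converges along `U`. It remains to see
  -- that the limit is a minimizer at `p`; uniqueness then identifies it.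
  intro U hU
  have hai : ∀ i, Tendsto (fun q => a q i) U (𝓝 (a p i)) := fun i =>
    ((continuous_apply i).comp ha).continuousAt.tendsto.mono_left hU
  have hbi : ∀ i, Tendsto (fun q => b q i) U (𝓝 (b p i)) := fun i =>
    ((continuous_apply i).comp hb).continuousAt.tendsto.mono_left hU
  have hcpt : IsCompact (Set.univ.pi fun i => Set.Icc (-(a p i + 1)) (b p i + 1)) :=
    isCompact_univ_pi fun i => isCompact_Icc
  have hmem : ∀ᶠ q in U, e q ∈ Set.univ.pi fun i => Set.Icc (-(a p i + 1)) (b p i + 1) := by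
    simp only [Set.mem_pi, Set.mem_univ, true_imp_iff]
    refine eventually_all.2 fun i => ?_
    filter_upwards [(hai i).eventually_lt_const (lt_add_one _),
      (hbi i).eventually_lt_const (lt_add_one _)] with q h1 h2
    have := (he q).1.2 i
    constructor <;> linarith
  obtain ⟨x, -, hx⟩ := hcpt.ultrafilter_le_nhds (U.map e) (le_principal_iff.2 hmem)
  have hx' : Tendsto e U (𝓝 x) := hx
  have hxi : ∀ i, Tendsto (fun q => e q i) U (𝓝 (x i)) := tendsto_pi_nhds.1 hx'
  suffices x = e p from this ▸ hx'
  refine IsMinShift.unique (W := W) (a := a p) (b := b p) ⟨⟨?_, fun i => ⟨?_, ?_⟩⟩, ?_⟩ (he p)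
  · exact (isClosed_dotOrthogonal W).mem_of_tendsto hx' (Eventually.of_forall fun q => (he q).1.1)
  · exact le_of_tendsto_of_tendsto' (hai i).neg (hxi i) fun q => ((he q).1.2 i).1
  · exact le_of_tendsto_of_tendsto' (hxi i) (hbi i) fun q => ((he q).1.2 i).2
  · intro f hf
    -- A competitor `f` at `p` may stick out of the nearby boxes. As these contain `0`, its multiple
    -- `c • f` with `c < 1` eventually fits; `c → 1` follows at the end.
    have key : ∀ c : ℝ, 0 ≤ c → c < 1 →
        ∑ i, (a p i - b p i + x i) ^ 2 ≤ ∑ i, (a p i - b p i + c * f i) ^ 2 := by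
      intro c hc0 hc1
      have hlow : ∀ {g : P → ℝ} {y : ℝ}, Tendsto g U (𝓝 y) → (∀ q, 0 ≤ g q) → 0 ≤ y →
          ∀ᶠ q in U, c * y ≤ g q := by
        intro g y hg hg0 hy
        rcases hy.eq_or_lt with rfl | hy
        · simpa using Eventually.of_forall hg0
        · filter_upwards [hg.eventually_const_lt (mul_lt_of_lt_one_left hy hc1)] with q hq
          exact hq.le
      have hmem : ∀ᶠ q in U, c • f ∈ boxSlice W (a q) (b q) := by
        have h1 := eventually_all.2 fun i => hlow (hai i) (fun q => ha0 q i) (ha0 p i)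
        have h2 := eventually_all.2 fun i => hlow (hbi i) (fun q => hb0 q i) (hb0 p i)
        filter_upwards [h1, h2] with q h1 h2
        refine ⟨Submodule.smul_mem _ _ hf.1, fun i => ?_⟩
        have h3 := mul_le_mul_of_nonneg_left (hf.2 i).1 hc0
        have h4 := mul_le_mul_of_nonneg_left (hf.2 i).2 hc0
        have h5 := h1 i
        have h6 := h2 i
        simp only [Pi.smul_apply, smul_eq_mul]
        constructor <;> linarith
      refine le_of_tendsto_of_tendsto
        (tendsto_finsetSum _ fun i _ => (((hai i).sub (hbi i)).add (hxi i)).pow 2)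
        (tendsto_finsetSum _ fun i _ => (((hai i).sub (hbi i)).add tendsto_const_nhds).pow 2) ?_
      filter_upwards [hmem] with q hq
      exact (he q).2 _ hq
    have hcont : Continuous fun c : ℝ => ∑ i, (a p i - b p i + c * f i) ^ 2 := by fun_prop
    have h1 : Tendsto (fun c : ℝ => ∑ i, (a p i - b p i + c * f i) ^ 2) (𝓝[<] 1)
        (𝓝 (∑ i, (a p i - b p i + f i) ^ 2)) := by
      have := hcont.tendsto 1
      simp only [one_mul] at this
      exact this.mono_left nhdsWithin_le_nhds
    refine ge_of_tendsto h1 ?_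
    filter_upwards [Ioo_mem_nhdsLT (zero_lt_one (α := ℝ))] with c hc
    exact key c hc.1.le hc.2

/-- At a minimal shift `e`, some element of `W` has the signs of `a - b + e`. -/
lemma IsMinShift.exists_sign {W : Submodule ℝ (ι → ℝ)} {a b e : ι → ℝ} (ha : ∀ i, 0 ≤ a i)
    (hb : ∀ i, 0 ≤ b i) (he : IsMinShift W a b e) :
    ∃ Y ∈ W, ∀ i, a i - b i + e i ≠ 0 → 0 < (a i - b i + e i) * Y i := by
  refine (gordan W fun i => a i - b i + e i).resolve_right ?_
  -- Subtracting a small positive multiple of `l` moves each coordinate with `l i ≠ 0` strictly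
  -- towards zero without crossing it, which contradicts minimality.
  rintro ⟨l, hl, hl0, hs⟩
  have hev : ∀ i, ∀ᶠ t in 𝓝[>] (0 : ℝ), |t * l i| ≤ |a i - b i + e i| := by
    intro i
    by_cases hi : a i - b i + e i = 0
    · simp [(hs i).2 hi]
    · have : Tendsto (fun t : ℝ => |t * l i|) (𝓝[>] 0) (𝓝 |0 * l i|) :=
        (Continuous.tendsto (by fun_prop) _).mono_left nhdsWithin_le_nhds
      rw [zero_mul, abs_zero] at this
      exact (this.eventually_lt_const (abs_pos.2 hi)).mono fun t h => h.le
  obtain ⟨t, ht, ht0⟩ := ((eventually_all.2 hev).and self_mem_nhdsWithin).exists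
  have ht0 : 0 < t := ht0
  have hlt : ∀ i, l i ≠ 0 → 0 < (a i - b i + e i) * (t * l i) ∧
      |t * l i| ≤ |a i - b i + e i| := by
    intro i hi
    refine ⟨?_, ht i⟩
    have h1 : a i - b i + e i ≠ 0 := fun h => hi ((hs i).2 h)
    have h2 := lt_of_le_of_ne (hs i).1 (mul_ne_zero h1 hi).symm
    have := mul_pos ht0 h2
    linarith
  -- Where the coordinate is positive, the new one is still nonnegative, so the shift is at least `b
  -- i - a i ≥ -a i`. The negative case is symmetric and uses `0 ≤ a i`.
  have hmem : e - t • l ∈ boxSlice W a b := by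
    refine ⟨sub_mem he.1.1 (Submodule.smul_mem _ _ hl), fun i => ?_⟩
    simp only [Pi.sub_apply, Pi.smul_apply, smul_eq_mul]
    have h1 := he.1.2 i
    by_cases hi : l i = 0
    · simpa [hi] using h1
    obtain ⟨h2, h3⟩ := hlt i hi
    have := ha i
    have := hb i
    rcases pos_and_pos_or_neg_and_neg_of_mul_pos h2 with ⟨h4, h5⟩ | ⟨h4, h5⟩
    · rw [abs_of_pos h4, abs_of_pos h5] at h3
      constructor <;> linarith
    · rw [abs_of_neg h4, abs_of_neg h5] at h3
      constructor <;> linarith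
  obtain ⟨j, hj⟩ := Function.ne_iff.1 hl0
  have hlt' : ∀ i, l i ≠ 0 → (a i - b i + (e - t • l) i) ^ 2 < (a i - b i + e i) ^ 2 := by
    intro i hi
    obtain ⟨h2, h3⟩ := hlt i hi
    simp only [Pi.sub_apply, Pi.smul_apply, smul_eq_mul]
    have h4 : (t * l i) ^ 2 ≤ (a i - b i + e i) * (t * l i) := by
      rw [← abs_of_pos h2, abs_mul, ← sq_abs (t * l i), sq]
      exact mul_le_mul_of_nonneg_right h3 (abs_nonneg _)
    nlinarith
  refine (he.2 _ hmem).not_gt (Finset.sum_lt_sum (fun i _ => ?_) ⟨j, Finset.mem_univ j, hlt' j hj⟩)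
  by_cases hi : l i = 0
  · simp [hi]
  · exact (hlt' i hi).le

end Polyhedral

/-! ### The fibre over the origin -/

section Fibre

variable {N : ℕ} (K : Subtorus N)

lemma mu1_apply (p : HSpace N) (Y : K.lie) :
    mu1 K p Y = Real.pi * ∑ i, (‖p.1 i‖ ^ 2 - ‖p.2 i‖ ^ 2) * Y.1 i := by
  simp [mu1, Subtorus.u]

lemma muC_apply (p : HSpace N) (Y : K.lie) :
    muC K p Y = (-2 * Real.pi * Complex.I) * ∑ i, (Y.1 i : ℂ) * (p.1 i * p.2 i) := by
  simp [muC, Subtorus.u]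

lemma isQuotientMap_mk (α : Module.Dual ℝ K.lie) (β : K.lie →ₗ[ℝ] ℂ) :
    IsQuotientMap (X.mk K : levelSet K α β → X K α β) := isQuotientMap_quotient_mk'

/-- `p` is destabilized to the origin by a one-parameter subgroup of `K_ℂ`. -/
def IsNilpotent (p : HSpace N) : Prop :=
  ∃ Y ∈ K.lie, ∀ i, (p.1 i ≠ 0 → 0 < Y i) ∧ (p.2 i ≠ 0 → Y i < 0)

/-- An orbit point close enough to `0` has smaller modulus than `p` in each nonzero coordinate; the
imaginary part `Y` of the group element then has the required signs. Conversely, flowing along such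
a `Y` contracts `p` to `0`. -/
lemma zero_mem_closure_orbitC_iff (p : HSpace N) :
    (0 : HSpace N) ∈ closure (orbitC K p) ↔ IsNilpotent K p := by
  constructor
  · intro h
    let O : Set (HSpace N) :=
      {r | ∀ i, (p.1 i ≠ 0 → ‖r.1 i‖ < ‖p.1 i‖) ∧ (p.2 i ≠ 0 → ‖r.2 i‖ < ‖p.2 i‖)}
    have hO : IsOpen O := by
      simp only [O, Set.ofPred_and, Set.ofPred_forall]
      refine isOpen_iInter_of_finite fun i => IsOpen.inter ?_ ?_
      · exact isOpen_iInter_of_finite fun _ => isOpen_lt (by fun_prop) continuous_const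
      · exact isOpen_iInter_of_finite fun _ => isOpen_lt (by fun_prop) continuous_const
    obtain ⟨_, hr, ⟨_, ⟨κ, hκ, Y, hY, rfl⟩, rfl⟩⟩ := mem_closure_iff.1 h O hO fun i => by simp
    refine ⟨Y, hY, fun i => ⟨fun hi => ?_, fun hi => ?_⟩⟩
    · have := (hr i).1 hi
      rw [actC_norm_fst, mul_lt_iff_lt_one_right (norm_pos_iff.2 hi), Real.exp_lt_one_iff] at this
      exact pos_of_mul_pos_right (neg_lt_zero.1 this) (by positivity)
    · have := (hr i).2 hi
      rw [actC_norm_snd, mul_lt_iff_lt_one_right (norm_pos_iff.2 hi), Real.exp_lt_one_iff] at this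
      exact neg_of_mul_neg_right this (by positivity)
  · rintro ⟨Y, hY, h⟩
    have hexp : ∀ c : ℝ, c < 0 → Tendsto (fun t : ℝ => Real.exp (2 * Real.pi * t * c)) atTop
        (𝓝 0) := fun c hc => by
      refine Real.tendsto_exp_atBot.comp ?_
      exact (tendsto_id.const_mul_atTop (by positivity)).atTop_mul_const_of_neg hc
    refine mem_closure_of_tendsto (b := atTop)
      (f := fun t : ℝ => actC (toComplexTorus 1 * expI (t • Y)) p) ?_
      (Eventually.of_forall fun t => ⟨_, ⟨1, one_mem _, _, K.lie.smul_mem t hY, rfl⟩, rfl⟩)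
    refine Tendsto.prodMk_nhds (tendsto_pi_nhds.2 fun i => ?_) (tendsto_pi_nhds.2 fun i => ?_) <;>
      refine tendsto_zero_iff_norm_tendsto_zero.2 ?_
    · change Tendsto (fun t : ℝ => ‖(actC (toComplexTorus 1 * expI (t • Y)) p).1 i‖) atTop (𝓝 0)
      simp only [actC_norm_fst, Pi.smul_apply, smul_eq_mul]
      by_cases hi : p.1 i = 0
      · simp [hi]
      · have := (hexp (-Y i) (neg_lt_zero.2 ((h i).1 hi))).const_mul ‖p.1 i‖
        simpa only [mul_zero, mul_neg, mul_assoc] using this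
    · change Tendsto (fun t : ℝ => ‖(actC (toComplexTorus 1 * expI (t • Y)) p).2 i‖) atTop (𝓝 0)
      simp only [actC_norm_snd, Pi.smul_apply, smul_eq_mul]
      by_cases hi : p.2 i = 0
      · simp [hi]
      · have := (hexp (Y i) ((h i).2 hi)).const_mul ‖p.2 i‖
        simpa only [mul_zero, mul_assoc] using this

lemma naturalMorphism_mk_eq_origin_iff {α : Module.Dual ℝ K.lie} (p : levelSet K α 0) :
    naturalMorphism K α 0 (X.mk K p) = origin K ↔ IsNilpotent K p.1 := by
  rw [← zero_mem_closure_orbitC_iff, naturalMorphism, Equiv.symm_apply_eq]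
  have h0 : (0 : HSpace N) ∈ levelSet K 0 0 := by simp [levelSet, mu1, muC]
  constructor
  · intro h
    -- The zero `q` of `μ₁` in the orbit closure represents the image of the point. By injectivity
    -- of `toGIT K 0 0` it is a `K`-translate of `0`.
    obtain ⟨q, hq, hq0⟩ := exists_mu1_zero K p.1
    have hql : q ∈ levelSet K 0 0 := ⟨hq0, (muC_of_mem_closure K hq).trans p.2.2⟩
    have h1 : toGIT K 0 0 (X.mk K ⟨q, hql⟩) = gitMap K α 0 (toGIT K α 0 (X.mk K p)) :=
      Quot.sound ⟨q, ⟨subset_closure (mem_orbitC_self K q), hq⟩,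
        mem_semistable_zero K hql.2⟩
    have h2 : X.mk K ⟨q, hql⟩ = origin K := (toGIT_zero_bijective K 0).1 (h1.trans h)
    obtain ⟨κ, hκ, hκq⟩ := Quotient.exact h2
    have hκq : act κ q = 0 := hκq
    rw [← hκq]
    exact closure_orbitC_subset K hq (subset_closure (act_mem_orbitC K hκ q))
  · intro h
    exact Quot.sound ⟨0, ⟨h, subset_closure (mem_orbitC_self K 0)⟩,
      mem_semistable_zero K h0.2⟩

end Fibre

/-! ### The equivariant contraction -/

section Contraction

/-- The nonnegative solution `a` of `a - b = y`, `a * b = c`, for `c ≥ 0`. -/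
noncomputable def upperRoot (y c : ℝ) : ℝ := (√(y ^ 2 + 4 * c) + y) / 2

lemma continuous_upperRoot : Continuous fun x : ℝ × ℝ => upperRoot x.1 x.2 := by
  unfold upperRoot; fun_prop

lemma upperRoot_nonneg (y : ℝ) {c : ℝ} (hc : 0 ≤ c) : 0 ≤ upperRoot y c := by
  have : |y| ≤ √(y ^ 2 + 4 * c) := Real.abs_le_sqrt (by linarith)
  have := neg_abs_le y
  unfold upperRoot
  linarith

lemma upperRoot_sub_neg (y c : ℝ) : upperRoot y c - upperRoot (-y) c = y := by
  simp only [upperRoot, neg_sq]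
  ring

lemma upperRoot_mul_neg (y : ℝ) {c : ℝ} (hc : 0 ≤ c) : upperRoot y c * upperRoot (-y) c = c := by
  have : √(y ^ 2 + 4 * c) ^ 2 = y ^ 2 + 4 * c := Real.sq_sqrt (by positivity)
  simp only [upperRoot, neg_sq]
  linear_combination this / 4

lemma upperRoot_sub_mul {a b : ℝ} (ha : 0 ≤ a) (hb : 0 ≤ b) : upperRoot (a - b) (a * b) = a := by
  have : √((a - b) ^ 2 + 4 * (a * b)) = a + b := by
    rw [show (a - b) ^ 2 + 4 * (a * b) = (a + b) ^ 2 by ring, Real.sqrt_sq (by positivity)]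
  rw [upperRoot, this]
  ring

lemma upperRoot_zero_of_nonpos {y : ℝ} (hy : y ≤ 0) : upperRoot y 0 = 0 := by
  simp [upperRoot, Real.sqrt_sq_eq_abs, abs_of_nonpos hy]

/-- The square root is at most `a + b - d`, since `(a + b - d)² - (a - b + d)² = 4a(b - d) ≥ 4(1 -
t)ab`. -/
lemma upperRoot_le {a b t d : ℝ} (ha : 0 ≤ a) (hb : 0 ≤ b) (ht : t ≤ 1) (hd : d ≤ t * b) :
    upperRoot (a - b + d) ((1 - t) * (a * b)) ≤ a := by
  have h1 : (1 - t) * b ≤ b - d := by linarith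
  have h0 : 0 ≤ (1 - t) * b := mul_nonneg (by linarith) hb
  have : √((a - b + d) ^ 2 + 4 * ((1 - t) * (a * b))) ≤ a + b - d := by
    refine Real.sqrt_le_iff.2 ⟨by linarith, ?_⟩
    nlinarith [mul_le_mul_of_nonneg_left h1 ha]
  unfold upperRoot
  linarith

/-- The multiple of `z` by a nonnegative real with squared norm `g`, if `z ≠ 0`. -/
noncomputable def rescale (z : ℂ) (g : ℝ) : ℂ := z * (√(g / ‖z‖ ^ 2) : ℝ)

lemma norm_sq_rescale {z : ℂ} {g : ℝ} (h0 : 0 ≤ g) (h1 : g ≤ ‖z‖ ^ 2) :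
    ‖rescale z g‖ ^ 2 = g := by
  rw [rescale, norm_mul, Complex.norm_real, mul_pow, Real.norm_eq_abs, sq_abs,
    Real.sq_sqrt (by positivity)]
  by_cases hz : z = 0
  · simp only [hz, norm_zero] at h1 ⊢
    linarith
  · have : ‖z‖ ≠ 0 := norm_ne_zero_iff.2 hz
    field_simp

lemma rescale_self (z : ℂ) : rescale z (‖z‖ ^ 2) = z := by
  by_cases hz : z = 0
  · simp [rescale, hz]
  · have : ‖z‖ ≠ 0 := norm_ne_zero_iff.2 hz
    simp [rescale, this]

lemma rescale_mul_of_norm_eq_one (z : ℂ) {c : ℂ} (g : ℝ) (hc : ‖c‖ = 1) :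
    rescale (z * c) g = rescale z g * c := by
  simp only [rescale, norm_mul, hc, mul_one]
  ring

lemma rescale_mul_rescale (z w : ℂ) {g h s : ℝ} (hg : 0 ≤ g)
    (hs : g * h = s * (‖z‖ ^ 2 * ‖w‖ ^ 2)) :
    rescale z g * rescale w h = (√s : ℝ) * (z * w) := by
  by_cases hz : z = 0
  · simp [rescale, hz]
  by_cases hw : w = 0
  · simp [rescale, hw]
  have h1 : ‖z‖ ≠ 0 := norm_ne_zero_iff.2 hz
  have h2 : ‖w‖ ≠ 0 := norm_ne_zero_iff.2 hw
  have h3 : √(g / ‖z‖ ^ 2) * √(h / ‖w‖ ^ 2) = √s := by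
    rw [← Real.sqrt_mul (by positivity), div_mul_div_comm, hs]
    congr 1
    field_simp
  rw [← h3, rescale, rescale]
  push_cast
  ring

/-- Only zeros of `z` are delicate, because the phase is discontinuous there; the bound `g ≤ ‖z‖²`
squeezes the value to `0`. -/
lemma continuous_rescale {P : Type*} [TopologicalSpace P] {z : P → ℂ} {g : P → ℝ}
    (hz : Continuous z) (hg : Continuous g) (h0 : ∀ p, 0 ≤ g p) (h1 : ∀ p, g p ≤ ‖z p‖ ^ 2) :
    Continuous fun p => rescale (z p) (g p) := by
  refine continuous_iff_continuousAt.2 fun p => ?_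
  by_cases hp : z p = 0
  · have hb : ∀ q, ‖rescale (z q) (g q)‖ ≤ ‖z q‖ := fun q => by
      refine le_of_sq_le_sq ?_ (norm_nonneg _)
      rw [norm_sq_rescale (h0 q) (h1 q)]
      exact h1 q
    have hz0 : Tendsto (fun q => ‖z q‖) (𝓝 p) (𝓝 0) := by
      have := hz.norm.tendsto p
      rwa [hp, norm_zero] at this
    have : rescale (z p) (g p) = 0 := by simp [rescale, hp]
    rw [ContinuousAt, this]
    exact squeeze_zero_norm hb hz0
  · have : ‖z p‖ ^ 2 ≠ 0 := by simpa using hp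
    unfold rescale
    refine hz.continuousAt.mul (Complex.continuous_ofReal.continuousAt.comp
      (Real.continuous_sqrt.continuousAt.comp ?_))
    exact hg.continuousAt.div (hz.norm.pow 2).continuousAt this

variable {N : ℕ} (K : Subtorus N)

/-- The point of norm data `a - b + t e` and complex moment `√(1 - t) z w` on the same real
half-lines as `(z, w)`, where `a = |z|²` and `b = |w|²`. -/
noncomputable def contract (e : Fin N → ℝ) (t : ℝ) (p : HSpace N) : HSpace N :=
  (fun i => rescale (p.1 i) (upperRoot (‖p.1 i‖ ^ 2 - ‖p.2 i‖ ^ 2 + t * e i)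
      ((1 - t) * (‖p.1 i‖ ^ 2 * ‖p.2 i‖ ^ 2))),
    fun i => rescale (p.2 i) (upperRoot (-(‖p.1 i‖ ^ 2 - ‖p.2 i‖ ^ 2 + t * e i))
      ((1 - t) * (‖p.1 i‖ ^ 2 * ‖p.2 i‖ ^ 2))))

lemma contract_act (e : Fin N → ℝ) (t : ℝ) (ζ : Fin N → Circle) (p : HSpace N) :
    contract e t (act ζ p) = act ζ (contract e t p) := by
  have h : ∀ i, ‖(((toComplexTorus ζ i)⁻¹ : ℂˣ) : ℂ)‖ = 1 := fun i => by
    simp [norm_toComplexTorus]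
  refine Prod.ext ?_ ?_ <;> funext i <;> simp only [contract, norm_act_fst, norm_act_snd]
  · exact rescale_mul_of_norm_eq_one _ _ (norm_toComplexTorus ζ i)
  · exact rescale_mul_of_norm_eq_one _ _ (h i)

/-- Covers both the start `t = 0` and the nilpotent points, where the product of moduli is already
`0` and the factor `1 - t` has no effect. -/
lemma contract_of_eq {e : Fin N → ℝ} {t : ℝ} {p : HSpace N} (he : ∀ i, t * e i = 0)
    (hp : ∀ i, t = 0 ∨ p.1 i = 0 ∨ p.2 i = 0) : contract e t p = p := by
  have hc : ∀ i, (1 - t) * (‖p.1 i‖ ^ 2 * ‖p.2 i‖ ^ 2) = ‖p.1 i‖ ^ 2 * ‖p.2 i‖ ^ 2 := fun i => by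
    rcases hp i with h | h | h <;> simp [h]
  refine Prod.ext ?_ ?_ <;> funext i <;> simp only [contract, he, add_zero, hc]
  · rw [upperRoot_sub_mul (by positivity) (by positivity), rescale_self]
  · rw [neg_sub, mul_comm (‖p.1 i‖ ^ 2), upperRoot_sub_mul (by positivity) (by positivity),
      rescale_self]

lemma upperRoot_le_norm_fst {e : Fin N → ℝ} {t : ℝ} {p : HSpace N}
    (he : ∀ i, -‖p.1 i‖ ^ 2 ≤ e i ∧ e i ≤ ‖p.2 i‖ ^ 2) (h0 : 0 ≤ t) (h1 : t ≤ 1) (i : Fin N) :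
    upperRoot (‖p.1 i‖ ^ 2 - ‖p.2 i‖ ^ 2 + t * e i)
      ((1 - t) * (‖p.1 i‖ ^ 2 * ‖p.2 i‖ ^ 2)) ≤ ‖p.1 i‖ ^ 2 :=
  upperRoot_le (by positivity) (by positivity) h1 (mul_le_mul_of_nonneg_left (he i).2 h0)

lemma upperRoot_le_norm_snd {e : Fin N → ℝ} {t : ℝ} {p : HSpace N}
    (he : ∀ i, -‖p.1 i‖ ^ 2 ≤ e i ∧ e i ≤ ‖p.2 i‖ ^ 2) (h0 : 0 ≤ t) (h1 : t ≤ 1) (i : Fin N) :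
    upperRoot (-(‖p.1 i‖ ^ 2 - ‖p.2 i‖ ^ 2 + t * e i))
      ((1 - t) * (‖p.1 i‖ ^ 2 * ‖p.2 i‖ ^ 2)) ≤ ‖p.2 i‖ ^ 2 := by
  have := mul_le_mul_of_nonneg_left (he i).1 h0
  rw [neg_add, neg_sub, mul_comm (‖p.1 i‖ ^ 2)]
  exact upperRoot_le (by positivity) (by positivity) h1 (by linarith)

lemma norm_sq_contract_sub {e : Fin N → ℝ} {t : ℝ} {p : HSpace N}
    (he : ∀ i, -‖p.1 i‖ ^ 2 ≤ e i ∧ e i ≤ ‖p.2 i‖ ^ 2) (h0 : 0 ≤ t) (h1 : t ≤ 1) (i : Fin N) :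
    ‖(contract e t p).1 i‖ ^ 2 - ‖(contract e t p).2 i‖ ^ 2 =
    ‖p.1 i‖ ^ 2 - ‖p.2 i‖ ^ 2 + t * e i := by
  have hc : 0 ≤ (1 - t) * (‖p.1 i‖ ^ 2 * ‖p.2 i‖ ^ 2) := mul_nonneg (by linarith) (by positivity)
  simp only [contract]
  rw [norm_sq_rescale (upperRoot_nonneg _ hc) (upperRoot_le_norm_fst he h0 h1 i),
    norm_sq_rescale (upperRoot_nonneg _ hc) (upperRoot_le_norm_snd he h0 h1 i), upperRoot_sub_neg]

lemma contract_mul {e : Fin N → ℝ} {t : ℝ} (h1 : t ≤ 1) (p : HSpace N) (i : Fin N) :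
    (contract e t p).1 i * (contract e t p).2 i = (√(1 - t) : ℝ) * (p.1 i * p.2 i) := by
  have hc : 0 ≤ (1 - t) * (‖p.1 i‖ ^ 2 * ‖p.2 i‖ ^ 2) := mul_nonneg (by linarith) (by positivity)
  exact rescale_mul_rescale _ _ (upperRoot_nonneg _ hc) (upperRoot_mul_neg _ hc)

/-! ### Invariance of the level set, fixed points and end points of the contraction. -/

lemma contract_mem_levelSet {α : Module.Dual ℝ K.lie} {e : Fin N → ℝ} {t : ℝ} {p : HSpace N}
    (he : e ∈ boxSlice K.lie (fun i => ‖p.1 i‖ ^ 2) fun i => ‖p.2 i‖ ^ 2) (h0 : 0 ≤ t)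
    (h1 : t ≤ 1) (hp : p ∈ levelSet K α 0) : contract e t p ∈ levelSet K α 0 := by
  refine ⟨?_, ?_⟩
  · rw [← hp.1]
    ext Y
    rw [mu1_apply, mu1_apply]
    congr 1
    have := he.1 Y.1 Y.2
    simp only [norm_sq_contract_sub he.2 h0 h1, add_mul, Finset.sum_add_distrib, mul_assoc,
      ← Finset.mul_sum, this, mul_zero, add_zero]
  · rw [← smul_zero (√(1 - t) : ℂ), ← hp.2]
    ext Y
    rw [LinearMap.smul_apply, muC_apply, muC_apply, smul_eq_mul]
    simp only [contract_mul h1, Finset.mul_sum]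
    exact Finset.sum_congr rfl fun i _ => by ring

/-- The box bounds and the signs of `Y` make every term `e i * Y i` nonpositive, while orthogonality
makes their sum zero. -/
lemma eq_zero_of_isNilpotent {p : HSpace N} (hp : IsNilpotent K p) {e : Fin N → ℝ}
    (he : e ∈ boxSlice K.lie (fun i => ‖p.1 i‖ ^ 2) fun i => ‖p.2 i‖ ^ 2) : e = 0 := by
  obtain ⟨Y, hY, h⟩ := hp
  have key : ∀ i, e i * Y i ≤ 0 ∧ (e i * Y i = 0 → e i = 0) := by
    intro i
    have he' := he.2 i
    by_cases h1 : p.1 i = 0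
    · by_cases h2 : p.2 i = 0
      · have : e i = 0 := by
          simp only [h1, h2, norm_zero] at he'
          linarith
        simp [this]
      · have hY := (h i).2 h2
        have : 0 ≤ e i := by simpa [h1] using he'.1
        exact ⟨mul_nonpos_of_nonneg_of_nonpos this hY.le, fun h => by simpa [hY.ne] using h⟩
    · have hY := (h i).1 h1
      have h2 : p.2 i = 0 := by
        by_contra h2
        exact lt_asymm hY ((h i).2 h2)
      have : e i ≤ 0 := by simpa [h2] using he'.2
      exact ⟨mul_nonpos_of_nonpos_of_nonneg this hY.le, fun h => by simpa [hY.ne'] using h⟩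
  have := (Finset.sum_eq_zero_iff_of_nonpos fun i _ => (key i).1).1 (he.1 Y hY)
  funext i
  exact (key i).2 (this i (Finset.mem_univ i))

lemma IsNilpotent.eq_zero_or {p : HSpace N} (hp : IsNilpotent K p) (i : Fin N) :
    p.1 i = 0 ∨ p.2 i = 0 := by
  obtain ⟨Y, -, h⟩ := hp
  by_contra! hi
  exact lt_asymm ((h i).1 hi.1) ((h i).2 hi.2)

/-- At `t = 1` the product of moduli vanishes, so `z_i` survives only where the shifted difference
is positive and `w_i` only where it is negative. -/
lemma isNilpotent_contract_one {e : Fin N → ℝ} {p : HSpace N}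
    (he : IsMinShift K.lie (fun i => ‖p.1 i‖ ^ 2) (fun i => ‖p.2 i‖ ^ 2) e) :
    IsNilpotent K (contract e 1 p) := by
  obtain ⟨Y, hY, h⟩ := he.exists_sign (fun i => by positivity) fun i => by positivity
  have hr : ∀ z : ℂ, rescale z 0 = 0 := fun z => by simp [rescale]
  refine ⟨Y, hY, fun i => ⟨fun hi => ?_, fun hi => ?_⟩⟩ <;>
    simp only [contract, one_mul, sub_self, zero_mul] at hi
  · have hy : 0 < ‖p.1 i‖ ^ 2 - ‖p.2 i‖ ^ 2 + e i := by
      by_contra! hy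
      exact hi (by rw [upperRoot_zero_of_nonpos hy, hr])
    exact pos_of_mul_pos_right (h i hy.ne') hy.le
  · have hy : ‖p.1 i‖ ^ 2 - ‖p.2 i‖ ^ 2 + e i < 0 := by
      by_contra! hy
      exact hi (by rw [upperRoot_zero_of_nonpos (neg_nonpos.2 hy), hr])
    exact neg_of_mul_pos_right (h i hy.ne) hy.le

theorem isEquivariantDeformationRetract_fibre (α : Module.Dual ℝ K.lie) :
    IsEquivariantDeformationRetract K.quotientTorus
      (naturalMorphism K α 0 ⁻¹' {origin K}) := by
  have hex : ∀ p : HSpace N, ∃ e, IsMinShift K.lie (fun i => ‖p.1 i‖ ^ 2)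
      (fun i => ‖p.2 i‖ ^ 2) e := fun p =>
    exists_isMinShift _ (fun i => by positivity) fun i => by positivity
  choose e he using hex
  have hcont : Continuous e := continuous_of_isMinShift K.lie (by fun_prop) (by fun_prop)
    (fun p i => by positivity) (fun p i => by positivity) he
  -- The minimization problem sees only moduli, so uniqueness makes its solution invariant. Both
  -- descent to the quotient by `K` and equivariance rest on this.
  have hinv : ∀ ζ p, e (act ζ p) = e p := fun ζ p => by
    have := he (act ζ p)
    simp only [norm_act_fst, norm_act_snd] at this
    exact this.unique (he p)
  have hmem : ∀ (t : unitInterval) (p : levelSet K α 0),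
      contract (e p.1) t p.1 ∈ levelSet K α 0 := fun t p =>
    contract_mem_levelSet K (he p.1).1 t.2.1 t.2.2 p.2
  have hact : ∀ (t : unitInterval) ζ (p : HSpace N),
      contract (e (act ζ p)) t (act ζ p) = act ζ (contract (e p) t p) := fun t ζ p => by
    rw [hinv, contract_act]
  let h : unitInterval → levelSet K α 0 → levelSet K α 0 := fun t p => ⟨_, hmem t p⟩
  let H : unitInterval × X K α 0 → X K α 0 := fun x =>
    Quotient.lift (fun p => X.mk K (h x.1 p)) (by
      rintro p q ⟨κ, hκ, hpq⟩
      refine Quotient.sound ⟨κ, hκ, ?_⟩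
      change act κ (contract (e p.1) x.1 p.1) = contract (e q.1) x.1 q.1
      rw [← hact, hpq]) x.2
  have hcont_h : Continuous fun x : unitInterval × levelSet K α 0 => h x.1 x.2 := by
    have hc : ∀ x : unitInterval × levelSet K α 0, ∀ i,
        0 ≤ (1 - (x.1 : ℝ)) * (‖x.2.1.1 i‖ ^ 2 * ‖x.2.1.2 i‖ ^ 2) := fun x i =>
      mul_nonneg (sub_nonneg.2 x.1.2.2) (by positivity)
    have hei : ∀ i, Continuous fun x : unitInterval × levelSet K α 0 => e x.2.1 i := fun i =>
      (continuous_apply i).comp (hcont.comp (continuous_subtype_val.comp continuous_snd))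
    refine Continuous.subtype_mk (Continuous.prodMk (continuous_pi fun i => ?_)
      (continuous_pi fun i => ?_)) _
    · exact continuous_rescale (by fun_prop)
        (continuous_upperRoot.comp (Continuous.prodMk (by fun_prop) (by fun_prop)))
        (fun x => upperRoot_nonneg _ (hc x i))
        fun x => upperRoot_le_norm_fst (he x.2.1).1.2 x.1.2.1 x.1.2.2 i
    · exact continuous_rescale (by fun_prop)
        (continuous_upperRoot.comp (Continuous.prodMk (by fun_prop) (by fun_prop)))
        (fun x => upperRoot_nonneg _ (hc x i))
        fun x => upperRoot_le_norm_snd (he x.2.1).1.2 x.1.2.1 x.1.2.2 i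
  -- The interval is locally compact, so its product with the quotient map is again a quotient map.
  have hcont_H : Continuous H := (isQuotientMap_mk K α 0).continuous_lift_prod_right
    ((isQuotientMap_mk K α 0).continuous.comp hcont_h)
  refine ⟨⟨H, hcont_H⟩, fun y => ?_, fun y => ?_, fun t y hy => ?_, fun t g y => ?_⟩ <;>
    induction y using Quotient.inductionOn with | _ p => ?_
  · refine congrArg (X.mk K) (Subtype.ext ?_)
    exact contract_of_eq (fun i => by simp) fun i => Or.inl (by simp)
  · exact (naturalMorphism_mk_eq_origin_iff K _).2 (isNilpotent_contract_one K (he p.1))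
  · have hp : IsNilpotent K p.1 := (naturalMorphism_mk_eq_origin_iff K p).1 hy
    refine congrArg (X.mk K) (Subtype.ext ?_)
    refine contract_of_eq (fun i => ?_) fun i => Or.inr (hp.eq_zero_or K i)
    rw [eq_zero_of_isNilpotent K hp (he p.1).1, Pi.zero_apply, mul_zero]
  · induction g using Quotient.inductionOn with | _ ζ => ?_
    exact congrArg (X.mk K) (Subtype.ext (hact t ζ p.1))

end Contraction

/-! ### The fibre as a union of compact toric subvarieties -/

section Components

variable {N : ℕ} (K : Subtorus N)

lemma isClosed_levelSet (α : Module.Dual ℝ K.lie) (β : K.lie →ₗ[ℝ] ℂ) :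
    IsClosed (levelSet K α β) := by
  have : levelSet K α β = (⋂ Y, {p | mu1 K p Y = α Y}) ∩ ⋂ Y, {p | muC K p Y = β Y} := by
    ext p
    simp [levelSet, LinearMap.ext_iff]
  rw [this]
  simp only [mu1_apply, muC_apply]
  exact (isClosed_iInter fun Y => isClosed_eq (by fun_prop) continuous_const).inter
    (isClosed_iInter fun Y => isClosed_eq (by fun_prop) continuous_const)

lemma isClosed_V (ε : Fin N → ℤˣ) : IsClosed (V ε) := by
  simp only [V, Set.ofPred_and, Set.ofPred_forall]
  refine isClosed_iInter fun i => IsClosed.inter ?_ ?_ <;>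
    exact isClosed_iInter fun _ => isClosed_eq (by fun_prop) continuous_const

lemma mul_sign_of_mem_V {ε : Fin N → ℤˣ} {p : HSpace N} (hp : p ∈ V ε) (i : Fin N) :
    ‖p.1 i‖ ^ 2 - ‖p.2 i‖ ^ 2 = ((ε i : ℤ) : ℝ) * (‖p.1 i‖ ^ 2 + ‖p.2 i‖ ^ 2) := by
  rcases Int.units_eq_one_or (ε i) with h | h
  · simp [h, (hp i).1 h]
  · simp [h, (hp i).2 h]

/-- On $V_\epsilon\cap\mu_1^{-1}(\alpha)$ one has $\alpha(Y)=\pi\sum_i(|z_i|^2+|w_i|^2)|Y_i|$. All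
terms are nonnegative, so each is bounded by $\alpha(Y)$; this gives the radii `r`. -/
lemma isCompact_M (α : Module.Dual ℝ K.lie) {ε : Fin N → ℤˣ} {Y : Fin N → ℝ} (hY : Y ∈ K.lie)
    (hε : ∀ i, 0 < ((ε i : ℤ) : ℝ) * Y i) : IsCompact (M K α ε) := by
  refine IsCompact.image ?_ (isQuotientMap_mk K α 0).continuous
  rw [Subtype.isCompact_iff]
  have himg : ((↑) : levelSet K α 0 → HSpace N) '' {p | p.1 ∈ V ε} = levelSet K α 0 ∩ V ε := by
    ext p; simp [and_comm]
  rw [himg]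
  let r : Fin N → ℝ := fun i => √(α ⟨Y, hY⟩ / (Real.pi * (((ε i : ℤ) : ℝ) * Y i)))
  refine ((isCompact_univ_pi fun i => isCompact_closedBall (0 : ℂ) (r i)).prod
    (isCompact_univ_pi fun i => isCompact_closedBall (0 : ℂ) (r i))).of_isClosed_subset
    ((isClosed_levelSet K α 0).inter (isClosed_V ε)) ?_
  rintro p ⟨hp, hpV⟩
  have key : ∀ i, ‖p.1 i‖ ^ 2 + ‖p.2 i‖ ^ 2 ≤
      α ⟨Y, hY⟩ / (Real.pi * (((ε i : ℤ) : ℝ) * Y i)) := by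
    intro i
    rw [le_div_iff₀ (mul_pos Real.pi_pos (hε i)), ← hp.1, mu1_apply]
    have h1 : ∀ j, (‖p.1 j‖ ^ 2 - ‖p.2 j‖ ^ 2) * Y j =
        (‖p.1 j‖ ^ 2 + ‖p.2 j‖ ^ 2) * (((ε j : ℤ) : ℝ) * Y j) := fun j => by
      rw [mul_sign_of_mem_V hpV]; ring
    have h2 : (‖p.1 i‖ ^ 2 + ‖p.2 i‖ ^ 2) * (((ε i : ℤ) : ℝ) * Y i) ≤
        ∑ j, (‖p.1 j‖ ^ 2 - ‖p.2 j‖ ^ 2) * Y j := by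
      simp only [h1]
      exact Finset.single_le_sum (f := fun j => (‖p.1 j‖ ^ 2 + ‖p.2 j‖ ^ 2) *
        (((ε j : ℤ) : ℝ) * Y j)) (fun j _ => mul_nonneg (by positivity) (hε j).le)
        (Finset.mem_univ i)
    calc _ = Real.pi * ((‖p.1 i‖ ^ 2 + ‖p.2 i‖ ^ 2) * (((ε i : ℤ) : ℝ) * Y i)) := by ring
      _ ≤ _ := mul_le_mul_of_nonneg_left h2 Real.pi_pos.le
  refine ⟨fun i _ => ?_, fun i _ => ?_⟩ <;> rw [mem_closedBall_zero_iff] <;>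
    refine Real.le_sqrt_of_sq_le (le_trans ?_ (key i))
  · exact le_add_of_nonneg_right (by positivity)
  · exact le_add_of_nonneg_left (by positivity)

/-- Finitely many proper subspaces, the kernels of the `K.u i`, do not cover a real vector space. -/
lemma exists_mem_lie_ne_zero (hu : ∀ i, K.u i ≠ 0) : ∃ Y ∈ K.lie, ∀ i, Y i ≠ 0 := by
  obtain ⟨Y, hY⟩ := Module.Dual.exists_forall_ne_zero_of_forall_exists K.u fun i => by
    by_contra! h
    exact hu i (LinearMap.ext h)
  exact ⟨Y, Y.2, hY⟩

/-- A nilpotent point lies in some `V_ε` such that `ε` is the sign vector of an element of `k`, if no `ι^* u_i` vanishes. -/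
lemma IsNilpotent.exists_sign (hu : ∀ i, K.u i ≠ 0) {p : HSpace N} (hp : IsNilpotent K p) :
    ∃ ε : Fin N → ℤˣ, p ∈ V ε ∧ ∃ Y ∈ K.lie, ∀ i, 0 < ((ε i : ℤ) : ℝ) * Y i := by
  obtain ⟨Y, hY, h⟩ := hp
  obtain ⟨Z, hZ, hZ0⟩ := exists_mem_lie_ne_zero K hu
  -- A small perturbation by `Z` keeps the signs of the nonzero coordinates of `Y` and removes its
  -- zeros.
  have hev : ∀ i, ∀ᶠ t in 𝓝[>] (0 : ℝ), Y i + t * Z i ≠ 0 ∧ (0 < Y i → 0 < Y i + t * Z i) ∧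
      (Y i < 0 → Y i + t * Z i < 0) := by
    intro i
    have hlim : Tendsto (fun t : ℝ => Y i + t * Z i) (𝓝[>] 0) (𝓝 (Y i + 0 * Z i)) :=
      (Continuous.tendsto (by fun_prop) _).mono_left nhdsWithin_le_nhds
    rw [zero_mul, add_zero] at hlim
    rcases lt_trichotomy (Y i) 0 with hi | hi | hi
    · filter_upwards [hlim.eventually_lt_const hi] with t ht
      exact ⟨ht.ne, fun h => absurd h hi.not_gt, fun _ => ht⟩
    · filter_upwards [self_mem_nhdsWithin] with t ht
      have ht : 0 < t := ht
      simp [hi, hZ0 i, ht.ne']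
    · filter_upwards [hlim.eventually_const_lt hi] with t ht
      exact ⟨ht.ne', fun _ => ht, fun h => absurd h hi.not_gt⟩
  obtain ⟨t, ht⟩ := (eventually_all.2 hev).exists
  refine ⟨fun i => if 0 < Y i + t * Z i then 1 else -1, fun i => ⟨fun hi => ?_, fun hi => ?_⟩,
    Y + t • Z, add_mem hY (K.lie.smul_mem t hZ), fun i => ?_⟩
  · by_contra hne
    have := (ht i).2.2 ((h i).2 hne)
    simp [this.not_gt] at hi
  · by_contra hne
    have := (ht i).2.1 ((h i).1 hne)
    simp [this] at hi
  · simp only [Pi.add_apply, Pi.smul_apply, smul_eq_mul]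
    split_ifs with hi
    · simpa using hi
    · have := lt_of_le_of_ne (not_lt.1 hi) (ht i).1
      simp only [Units.val_neg, Units.val_one, Int.cast_neg, Int.cast_one]
      linarith

/-- Adding a sign-compatible relation `l` to the norm data of a point of `V_ε`. -/
lemma exists_mem_V_add {α : Module.Dual ℝ K.lie} {ε : Fin N → ℤˣ} {p : HSpace N}
    (hp : p ∈ levelSet K α 0) (hpV : p ∈ V ε) {l : Fin N → ℝ} (hl : l ∈ dotOrthogonal K.lie)
    (hs : ∀ i, 0 ≤ ((ε i : ℤ) : ℝ) * l i) : ∃ q ∈ levelSet K α 0, q ∈ V ε ∧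
      ∀ i, ‖q.1 i‖ ^ 2 + ‖q.2 i‖ ^ 2 = ‖p.1 i‖ ^ 2 + ‖p.2 i‖ ^ 2 + ((ε i : ℤ) : ℝ) * l i := by
  -- Only moduli matter for `μ₁`, so the phases of `p` can be dropped and a real point used.
  let g : Fin N → ℝ := fun i => √(‖p.1 i‖ ^ 2 + ‖p.2 i‖ ^ 2 + ((ε i : ℤ) : ℝ) * l i)
  have hg : ∀ i, g i ^ 2 = ‖p.1 i‖ ^ 2 + ‖p.2 i‖ ^ 2 + ((ε i : ℤ) : ℝ) * l i := fun i =>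
    Real.sq_sqrt (add_nonneg (by positivity) (hs i))
  let q : HSpace N := (fun i => if ε i = 1 then (g i : ℂ) else 0,
    fun i => if ε i = 1 then 0 else (g i : ℂ))
  have hqV : q ∈ V ε := fun i => ⟨fun hi => by simp [q, hi], fun hi => by simp [q, hi]⟩
  have hq : ∀ i, ‖q.1 i‖ ^ 2 + ‖q.2 i‖ ^ 2 =
      ‖p.1 i‖ ^ 2 + ‖p.2 i‖ ^ 2 + ((ε i : ℤ) : ℝ) * l i := fun i => by
    rw [← hg]
    by_cases hi : ε i = 1 <;> simp [q, hi]
  have hsq : ∀ i, ((ε i : ℤ) : ℝ) * ((ε i : ℤ) : ℝ) = 1 := fun i => by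
    rcases Int.units_eq_one_or (ε i) with h | h <;> simp [h]
  refine ⟨q, ⟨?_, ?_⟩, hqV, hq⟩
  · rw [← hp.1]
    ext Y
    rw [mu1_apply, mu1_apply]
    have h1 : ∀ i, (‖q.1 i‖ ^ 2 - ‖q.2 i‖ ^ 2) * Y.1 i =
        (‖p.1 i‖ ^ 2 - ‖p.2 i‖ ^ 2) * Y.1 i + l i * Y.1 i := fun i => by
      rw [mul_sign_of_mem_V hqV, mul_sign_of_mem_V hpV, hq]
      linear_combination l i * Y.1 i * hsq i
    simp only [h1, Finset.sum_add_distrib, hl Y.1 Y.2, add_zero]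
  · ext Y
    have h1 : ∀ i, q.1 i * q.2 i = 0 := fun i => by
      by_cases hi : ε i = 1 <;> simp [q, hi]
    simp [muC_apply, h1]

/-- Points of a compact `M_ε(α)` are nilpotent. -/
lemma isNilpotent_of_isCompact_M {α : Module.Dual ℝ K.lie} {ε : Fin N → ℤˣ}
    (hε : IsCompact (M K α ε)) {p : levelSet K α 0} (hp : p.1 ∈ V ε) : IsNilpotent K p.1 := by
  have hε0 : ∀ i, ((ε i : ℤ) : ℝ) ≠ 0 := fun i => by simp
  obtain ⟨Y, hY, h⟩ | ⟨l, hl, hl0, hs⟩ := gordan K.lie fun i => ((ε i : ℤ) : ℝ)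
  · refine ⟨Y, hY, fun i => ?_⟩
    have := h i (hε0 i)
    rcases Int.units_eq_one_or (ε i) with hi | hi
    · simpa [hi, (hp i).1 hi] using fun _ => this
    · simpa [hi, (hp i).2 hi] using fun _ => this
  · exfalso
    obtain ⟨j, hj⟩ := Function.ne_iff.1 hl0
    have hpos : 0 < ((ε j : ℤ) : ℝ) * l j :=
      lt_of_le_of_ne (hs j).1 (mul_ne_zero (hε0 j) hj).symm
    -- A continuous `K`-invariant function, hence bounded on the compact `M K α ε`; adding multiples
    -- of `l` to `p` will exceed any bound.
    let ν : X K α 0 → ℝ := Quotient.lift (fun q => ‖q.1.1 j‖ ^ 2 + ‖q.1.2 j‖ ^ 2) (by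
      rintro a b ⟨κ, -, hab⟩
      simp only [← hab, norm_act_fst, norm_act_snd])
    have hν : Continuous ν := (isQuotientMap_mk K α 0).continuous_iff.2
      (show Continuous fun q : levelSet K α 0 => ‖q.1.1 j‖ ^ 2 + ‖q.1.2 j‖ ^ 2 by fun_prop)
    obtain ⟨B, hB⟩ := hε.bddAbove_image hν.continuousOn
    -- Chosen so that adding `t • l` raises `ν` by exactly `|B| + 1`.
    let t : ℝ := (|B| + 1) / (((ε j : ℤ) : ℝ) * l j)
    have ht : 0 ≤ t := by positivity
    obtain ⟨q, hq, hqV, hqn⟩ := exists_mem_V_add K p.2 hp (Submodule.smul_mem _ t hl)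
      fun i => by
        have := mul_nonneg ht (hs i).1
        simp only [Pi.smul_apply, smul_eq_mul]
        linarith
    have h1 : ‖q.1 j‖ ^ 2 + ‖q.2 j‖ ^ 2 ≤ B := hB ⟨X.mk K ⟨q, hq⟩, ⟨⟨q, hq⟩, hqV, rfl⟩, rfl⟩
    have h2 : ((ε j : ℤ) : ℝ) * (t • l) j = |B| + 1 := by
      simp only [Pi.smul_apply, smul_eq_mul]
      rw [mul_left_comm, div_mul_cancel₀ _ hpos.ne']
    rw [hqn, h2] at h1
    have := le_abs_self B
    have : 0 ≤ ‖p.1.1 j‖ ^ 2 + ‖p.1.2 j‖ ^ 2 := by positivity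
    linarith

theorem fibre_eq_iUnion_compactSigns (α : Module.Dual ℝ K.lie) (hu : ∀ i, K.u i ≠ 0) :
    naturalMorphism K α 0 ⁻¹' {origin K} = ⋃ ε ∈ compactSigns K α, M K α ε := by
  ext x
  simp only [Set.mem_preimage, Set.mem_singleton_iff, Set.mem_iUnion, exists_prop]
  constructor
  · intro hx
    induction x using Quotient.inductionOn with | _ p => ?_
    obtain ⟨ε, hε, Y, hY, hY0⟩ :=
      ((naturalMorphism_mk_eq_origin_iff K p).1 hx).exists_sign K hu
    exact ⟨ε, isCompact_M K α hY hY0, p, hε, rfl⟩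
  · rintro ⟨ε, hε, p, hp, rfl⟩
    exact (naturalMorphism_mk_eq_origin_iff K p).2 (isNilpotent_of_isCompact_M K hε hp)

end Components

end ToricHK

theorem mainTheorem4 {N : ℕ} (K : ToricHK.Subtorus N) (α : Module.Dual ℝ K.lie) :
    ToricHK.IsEquivariantDeformationRetract K.quotientTorus
        (ToricHK.naturalMorphism K α 0 ⁻¹' {ToricHK.origin K}) ∧
      ((∀ i, K.u i ≠ 0) →
        ToricHK.naturalMorphism K α 0 ⁻¹' {ToricHK.origin K} =
          ⋃ ε ∈ ToricHK.compactSigns K α, ToricHK.M K α ε) :=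
  ⟨ToricHK.isEquivariantDeformationRetract_fibre K α,
    ToricHK.fibre_eq_iUnion_compactSigns K α⟩
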